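/- Terms are pure $\lambda$-terms; $\simeq_\beta$ is $\beta$-equivalence and $u\succ_f v$ means that $v$ is obtained from $u$ by finitely many (possibly zero) weak head reduction steps $(\lambda x\,u)\,v\,v_1\cdots v_m\to u[v/x]\,v_1\cdots v_m$. Types are built from type variables and type constants (among them a distinguished constant $\bot$) with $\to$ and $\forall$; only proper types are considered, i.e. in every subformula $\forall X A$ the variable $X$ occurs free in $A$. A type is closed if it has no free type variable. Let $\vdash_{\mathcal F}$ be typability in the Curry-style system $\mathcal F$ (axiom, introduction and elimination of $\to$ and of $\forall$), and let $\mathcal F_0$ be $\mathcal F$ without the $\forall$-elimination rule. A closed type $E$ is an *input type* if every normal $t$ with $\vdash_{\mathcal F} t:E$ satisfies $\vdash_{\mathcal F_0} t:E$. A closed type $S$ is an *output type* if, for every normal $t$, $\vdash_{\mathcal F}\lambda x\,t:\forall X(X\to S)$ implies that $x$ is not free in $t$. A *syntactical data type* is a closed type that is both an input and an output type. Put $\neg A = A\to\bot$, and let $A^*$ be obtained from $A$ by replacing each atomic formula $R$ by $\neg R$. A closed term $T$ is a *storage operator* for $D$ if for every term $t$ with $\vdash_{\mathcal F} t:D$ there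 are terms $\tau\simeq_\beta\tau'$ with $\vdash_{\mathcal F}\tau':D$ such that for every term $\theta\simeq_\beta t$ and every variable $f$ not free in $\theta$ there is a substitution $\sigma$ with $T\,\theta\,f\succ_f f\,\sigma(\tau)$. **Theorem.** Let $D$ be a syntactical data type in which $\bot$ does not occur, and let $T$ be a term with $\vdash_{\mathcal F} T: D^*\to\neg\neg D$. Then $T$ is (closed and) a storage operator for $D$. -/

import Mathlib

namespace SystemF

/-! ### Pure lambda-terms, up to renaming of bound variables (de Bruijn indices) -/

/-- Pure lambda-terms; `var n` is the `n`-th variable, counted from the innermost binder. -/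
inductive Term : Type
  | var : ℕ → Term
  | app : Term → Term → Term
  | lam : Term → Term

namespace Term

/-- The variable `n` occurs free in the term. -/
def Free : ℕ → Term → Prop
  | n, var m => m = n
  | n, app u v => Free n u ∨ Free n v
  | n, lam u => Free (n + 1) u

/-- A term without free variables. -/
def Closed (t : Term) : Prop := ∀ n, ¬ Free n t

/-- Extension of a renaming of variables below one binder. -/
def upRen (ξ : ℕ → ℕ) : ℕ → ℕ
  | 0 => 0
  | n + 1 => ξ n + 1

/-- Renaming of free variables. -/
def rename : (ℕ → ℕ) → Term → Term
  | ξ, var n => var (ξ n)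
  | ξ, app u v => app (rename ξ u) (rename ξ v)
  | ξ, lam u => lam (rename (upRen ξ) u)

/-- Extension of a substitution below one binder. -/
def upSub (σ : ℕ → Term) : ℕ → Term
  | 0 => var 0
  | n + 1 => rename Nat.succ (σ n)

/-- Simultaneous capture-avoiding substitution of the terms `σ n` for the free variables. -/
def subst : (ℕ → Term) → Term → Term
  | σ, var n => σ n
  | σ, app u v => app (subst σ u) (subst σ v)
  | σ, lam u => lam (subst (upSub σ) u)

/-- The substitution sending variable `0` to `v` and lowering all the other variables by one. -/
def single (v : Term) : ℕ → Term
  | 0 => v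
  | n + 1 => var n

/-- The contractum `u[v/x]` of the redex `(λx u) v`. -/
def inst (u v : Term) : Term := subst (single v) u

/-- One step of beta-reduction, anywhere in the term. -/
inductive Beta : Term → Term → Prop
  | redex (u v : Term) : Beta (app (lam u) v) (inst u v)
  | appL {u u' : Term} (v : Term) : Beta u u' → Beta (app u v) (app u' v)
  | appR (u : Term) {v v' : Term} : Beta v v' → Beta (app u v) (app u v')
  | lam {u u' : Term} : Beta u u' → Beta (lam u) (lam u')

/-- A (beta-)normal term. -/
def Normal (t : Term) : Prop := ∀ u, ¬ Beta t u

/-- Beta-equivalence. -/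
def BetaEq : Term → Term → Prop := Relation.EqvGen Beta

/-- One step of weak head reduction:
`(λx u) v v₁ … vₘ` reduces to `u[v/x] v₁ … vₘ`. -/
inductive WHStep : Term → Term → Prop
  | redex (u v : Term) : WHStep (app (lam u) v) (inst u v)
  | app {u u' : Term} (v : Term) : WHStep u u' → WHStep (app u v) (app u' v)

/-- Weak head reduction, in finitely many (possibly zero) steps. -/
def WHRed : Term → Term → Prop := Relation.ReflTransGen WHStep

end Term

/-! ### Types -/

/-- Formulas built from type variables (de Bruijn indices) and type constants with `→` and `∀`. -/
inductive Ty : Type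
  | var : ℕ → Ty
  | cst : ℕ → Ty
  | arr : Ty → Ty → Ty
  | all : Ty → Ty

namespace Ty

/-- The type variable `n` occurs free in the type. -/
def Free : ℕ → Ty → Prop
  | n, var m => m = n
  | _, cst _ => False
  | n, arr A B => Free n A ∨ Free n B
  | n, all A => Free (n + 1) A

/-- A type without free type variables. -/
def Closed (A : Ty) : Prop := ∀ n, ¬ Free n A

/-- The type constant `c` occurs in the type. -/
def HasCst (c : ℕ) : Ty → Prop
  | var _ => False
  | cst d => d = c
  | arr A B => HasCst c A ∨ HasCst c B
  | all A => HasCst c A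

/-- Proper types: every quantified variable occurs free in the scope of its quantifier. -/
def Proper : Ty → Prop
  | var _ => True
  | cst _ => True
  | arr A B => Proper A ∧ Proper B
  | all A => Free 0 A ∧ Proper A

/-- Extension of a renaming of type variables below one quantifier. -/
def upRen (ξ : ℕ → ℕ) : ℕ → ℕ
  | 0 => 0
  | n + 1 => ξ n + 1

/-- Renaming of free type variables. -/
def rename : (ℕ → ℕ) → Ty → Ty
  | ξ, var n => var (ξ n)
  | _, cst c => cst c
  | ξ, arr A B => arr (rename ξ A) (rename ξ B)
  | ξ, all A => all (rename (upRen ξ) A)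

/-- The same type, read below one more quantifier. -/
def shift (A : Ty) : Ty := rename Nat.succ A

/-- Extension of a substitution below one quantifier. -/
def upSub (σ : ℕ → Ty) : ℕ → Ty
  | 0 => var 0
  | n + 1 => shift (σ n)

/-- Simultaneous capture-avoiding substitution of types for the free type variables. -/
def subst : (ℕ → Ty) → Ty → Ty
  | σ, var n => σ n
  | _, cst c => cst c
  | σ, arr A B => arr (subst σ A) (subst σ B)
  | σ, all A => all (subst (upSub σ) A)

/-- The substitution sending type variable `0` to `C` and lowering the other ones by one. -/
def single (C : Ty) : ℕ → Ty
  | 0 => C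
  | n + 1 => var n

/-- The instance `A[C/X]` of the body `A` of a type `∀X A`. -/
def inst (A C : Ty) : Ty := subst (single C) A

/-- The distinguished type constant `⊥`. -/
def bot : Ty := cst 0

/-- The constant `⊥` occurs in the type. -/
def HasBot (A : Ty) : Prop := HasCst 0 A

/-- `¬A` is `A → ⊥`. -/
def neg (A : Ty) : Ty := arr A bot

/-- The Gödel translation `A*`: every atomic formula `R` of `A` is replaced by `¬R`. -/
def star : Ty → Ty
  | var n => neg (var n)
  | cst c => neg (cst c)
  | arr A B => arr (star A) (star B)
  | all A => all (star A)

end Ty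

/-! ### Typing -/

/-- `TypF Γ t A`: in system F, the term `t` has type `A` in the context `Γ`, whose `i`-th entry is
the type of variable `i`. All the types of a derivation are proper. -/
inductive TypF : List Ty → Term → Ty → Prop
  | ax {Γ : List Ty} {i : ℕ} {A : Ty} :
      (∀ B ∈ Γ, B.Proper) → Γ[i]? = some A → TypF Γ (Term.var i) A
  | arrI {Γ : List Ty} {t : Term} {B C : Ty} :
      TypF (B :: Γ) t C → TypF Γ (Term.lam t) (Ty.arr B C)
  | arrE {Γ : List Ty} {u v : Term} {B C : Ty} :
      TypF Γ u (Ty.arr B C) → TypF Γ v B → TypF Γ (Term.app u v) C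
  | allI {Γ : List Ty} {t : Term} {A : Ty} :
      TypF (Γ.map Ty.shift) t A → A.Free 0 → TypF Γ t (Ty.all A)
  | allE {Γ : List Ty} {t : Term} {A C : Ty} :
      TypF Γ t (Ty.all A) → C.Proper → TypF Γ t (A.inst C)

/-- Typing in the system F₀, which is system F without elimination of quantifiers. -/
inductive TypF₀ : List Ty → Term → Ty → Prop
  | ax {Γ : List Ty} {i : ℕ} {A : Ty} :
      (∀ B ∈ Γ, B.Proper) → Γ[i]? = some A → TypF₀ Γ (Term.var i) A
  | arrI {Γ : List Ty} {t : Term} {B C : Ty} :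
      TypF₀ (B :: Γ) t C → TypF₀ Γ (Term.lam t) (Ty.arr B C)
  | arrE {Γ : List Ty} {u v : Term} {B C : Ty} :
      TypF₀ Γ u (Ty.arr B C) → TypF₀ Γ v B → TypF₀ Γ (Term.app u v) C
  | allI {Γ : List Ty} {t : Term} {A : Ty} :
      TypF₀ (Γ.map Ty.shift) t A → A.Free 0 → TypF₀ Γ t (Ty.all A)

/-! ### Syntactical data types and storage operators -/

/-- Input types: closed types `E` such that every normal term of type `E` in system F has type `E`
in the system F₀. -/
def IsInput (E : Ty) : Prop :=
  E.Proper ∧ E.Closed ∧ ∀ t : Term, t.Normal → TypF [] t E → TypF₀ [] t E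

/-- Output types: closed types `S` such that `x` is not free in `t` whenever `t` is normal and
`λx t` has type `∀X (X → S)`. -/
def IsOutput (S : Ty) : Prop :=
  S.Proper ∧ S.Closed ∧ ∀ t : Term, t.Normal →
    TypF [] (Term.lam t) (Ty.all (Ty.arr (Ty.var 0) S.shift)) → ¬ t.Free 0

/-- Syntactical data types: types that are both input types and output types. -/
def IsSyntacticalDataType (D : Ty) : Prop := IsInput D ∧ IsOutput D

/-- The closed term `T` is a storage operator for `D`: for every `t` of type `D` there are
beta-equivalent terms `τ`, `τ'`, the second of type `D`, such that for every `θ` beta-equivalent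
to `t` and every new variable `f`, the term `T θ f` reduces by weak head reduction to `f σ(τ)`
for some substitution `σ`. -/
def IsStorageOperator (D : Ty) (T : Term) : Prop :=
  T.Closed ∧ ∀ t : Term, TypF [] t D →
    ∃ τ τ' : Term, Term.BetaEq τ τ' ∧ TypF [] τ' D ∧
      ∀ θ : Term, Term.BetaEq θ t → ∀ f : ℕ, ¬ θ.Free f →
        ∃ σ : ℕ → Term,
          Term.WHRed (Term.app (Term.app T θ) (Term.var f))
            (Term.app (Term.var f) (τ.subst σ))

end SystemF

/-! By strong normalization a term `t` of type `D` has a normal form `u`, and `u` is typable without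
∀-elimination because `D` is an input type. That is the one rule the Gödel translation does not
respect, so `u` also has type `D*` (`TypF₀.star`), and `T u f` has type `⊥` when `f : ¬D`.

The head reduction of `T θ f` must follow one course for all `θ` equivalent to `u`. So `T x f` is
reduced symbolically. When a variable standing for a piece of `u` comes to head position, the F₀
derivation of that piece tells what it does with its arguments, and its translated type guarantees
that they have the right types (`TypF₀.eval_closure`). Pieces of `u` not yet evaluated are kept as
closures named by fresh variables, as in a call-by-name machine. By standardization every `θ` weak
head reduces, hereditarily, to the shapes found in `u`, so every `θ` realizes the same run.

The run is finite because it is tracked by a weak head reduction of the strongly normalizing term `T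
u f`; a stage without actual reduction only fetches an environment entry, which uses older variables
(`ClosureCtx.head_reduction`). It can end only at `f τ` with `τ : D`, as `f` is the only variable
that names no closure.

All variables of `τ` have types ending with `⊥`. Replace `⊥` by a new type variable `X`, and each
variable by a suitable `λ…λ x` with `x : X`. The type `D`, closed and free of `⊥`, does not change,
so the output property forbids `x`, and the normal form `τ'` of `τ` is closed
(`IsOutput.closed_of_endsBot`). -/

namespace SystemF

/-! ### Substitution in types -/

namespace Ty

/-- Simultaneous substitution of `c` for the constant `⊥` and of `σ n` for the variables. -/
def msub : Ty → (ℕ → Ty) → Ty → Ty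
  | _, σ, var n => σ n
  | c, _, cst d => if d = 0 then c else cst d
  | c, σ, arr A B => arr (msub c σ A) (msub c σ B)
  | c, σ, all A => all (msub (shift c) (upSub σ) A)

/-- The substitution sending `0` to `C` and `n + 1` to `σ n`. -/
def cons (C : Ty) (σ : ℕ → Ty) : ℕ → Ty
  | 0 => C
  | n + 1 => σ n

theorem rename_rename (A : Ty) : ∀ ξ ζ : ℕ → ℕ,
    rename ζ (rename ξ A) = rename (fun n => ζ (ξ n)) A := by
  induction A with
  | var n => intros; rfl
  | cst d => intros; rfl
  | arr A B hA hB => intro ξ ζ; simp only [rename, hA, hB]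
  | all A hA =>
    intro ξ ζ
    simp only [rename, hA]
    congr 2; funext n; cases n <;> rfl

theorem rename_eq_subst (A : Ty) : ∀ ξ : ℕ → ℕ, rename ξ A = subst (fun n => var (ξ n)) A := by
  induction A with
  | var n => intros; rfl
  | cst d => intros; rfl
  | arr A B hA hB => intro ξ; simp only [rename, subst, hA, hB]
  | all A hA =>
    intro ξ
    simp only [rename, subst, hA]
    congr 2; funext n; cases n <;> rfl

theorem subst_eq_msub (A : Ty) : ∀ σ : ℕ → Ty, subst σ A = msub bot σ A := by
  induction A with
  | var n => intros; rfl
  | cst d => intro σ; by_cases h : d = 0 <;> simp [subst, msub, h, bot]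
  | arr A B hA hB => intro σ; simp only [msub, subst, hA, hB]
  | all A hA => intro σ; simp only [msub, subst, hA]; rfl

theorem msub_rename (A : Ty) : ∀ (c : Ty) (σ : ℕ → Ty) (ξ : ℕ → ℕ),
    msub c σ (rename ξ A) = msub c (fun n => σ (ξ n)) A := by
  induction A with
  | var n => intros; rfl
  | cst d => intros; rfl
  | arr A B hA hB => intro c σ ξ; simp only [msub, rename, hA, hB]
  | all A hA =>
    intro c σ ξ
    simp only [msub, rename, hA]
    congr 2; funext n; cases n <;> rfl

theorem rename_shift (A : Ty) (ξ : ℕ → ℕ) :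
    rename (upRen ξ) (shift A) = shift (rename ξ A) := by
  simp only [shift, rename_rename]; rfl

theorem rename_msub (A : Ty) : ∀ (c : Ty) (σ : ℕ → Ty) (ξ : ℕ → ℕ),
    rename ξ (msub c σ A) = msub (rename ξ c) (fun n => rename ξ (σ n)) A := by
  induction A with
  | var n => intros; rfl
  | cst d => intro c σ ξ; by_cases h : d = 0 <;> simp [rename, msub, h]
  | arr A B hA hB => intro c σ ξ; simp only [msub, rename, hA, hB]
  | all A hA =>
    intro c σ ξ
    simp only [msub, rename, hA, rename_shift]
    congr 2; funext n; cases n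
    · rfl
    · exact rename_shift _ _

theorem msub_shift (A c : Ty) (σ : ℕ → Ty) :
    msub (shift c) (upSub σ) (shift A) = shift (msub c σ A) := by
  simp only [shift, msub_rename, rename_msub]; rfl

theorem msub_msub (A : Ty) : ∀ (c d : Ty) (σ τ : ℕ → Ty),
    msub d τ (msub c σ A) = msub (msub d τ c) (fun n => msub d τ (σ n)) A := by
  induction A with
  | var n => intros; rfl
  | cst e => intro c d σ τ; by_cases h : e = 0 <;> simp [msub, h]
  | arr A B hA hB => intro c d σ τ; simp only [msub, hA, hB]
  | all A hA =>
    intro c d σ τ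
    simp only [msub, hA, msub_shift]
    congr 2; funext n; cases n
    · rfl
    · exact msub_shift _ _ _

theorem msub_var (A : Ty) : msub bot var A = A := by
  induction A with
  | var n => rfl
  | cst d => by_cases h : d = 0 <;> simp [msub, h, bot]
  | arr A B hA hB => simp only [msub, hA, hB]
  | all A hA =>
    have : upSub var = var := by funext n; cases n <;> rfl
    simp only [msub, this]; exact congrArg _ hA

theorem msub_cons_shift (A c C : Ty) (σ : ℕ → Ty) : msub c (cons C σ) (shift A) = msub c σ A := by
  rw [shift, msub_rename]; rfl

theorem inst_shift (A C : Ty) : (shift A).inst C = A := by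
  rw [inst, subst_eq_msub, shift, msub_rename]; exact msub_var A

theorem inst_msub (A C c : Ty) (σ : ℕ → Ty) :
    (msub (shift c) (upSub σ) A).inst C = msub c (cons C σ) A := by
  rw [inst, subst_eq_msub, msub_msub]
  have h : ∀ B, msub bot (single C) (shift B) = B := fun B => by
    rw [← subst_eq_msub]; exact inst_shift B C
  rw [h]
  congr 1; funext n; cases n
  · rfl
  · exact h _

theorem msub_inst (A C c : Ty) (σ : ℕ → Ty) :
    msub c σ (A.inst C) = (msub (shift c) (upSub σ) A).inst (msub c σ C) := by
  rw [inst_msub, inst, subst_eq_msub, msub_msub]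
  congr 1; funext n; cases n <;> rfl

theorem inst_var_zero (A : Ty) : (rename (upRen Nat.succ) A).inst (var 0) = A := by
  rw [inst, subst_eq_msub, msub_rename]
  refine Eq.trans ?_ (msub_var A)
  congr 1; funext n; cases n <;> rfl

theorem Free.rename {A : Ty} : ∀ {n : ℕ} (ξ : ℕ → ℕ), Free n A → Free (ξ n) (rename ξ A) := by
  induction A with
  | var m => intro n ξ h; exact congrArg ξ h
  | cst d => intro n ξ h; exact h
  | arr A B hA hB => intro n ξ h; exact h.imp (hA ξ) (hB ξ)
  | all A hA => intro n ξ h; exact hA (upRen ξ) h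

theorem Free.msub {A : Ty} : ∀ {n m : ℕ} (c : Ty) {σ : ℕ → Ty},
    Free n A → Free m (σ n) → Free m (msub c σ A) := by
  induction A with
  | var k => intro n m c σ h hm; cases h; exact hm
  | cst d => intro n m c σ h; exact h.elim
  | arr A B hA hB => intro n m c σ h hm; exact h.imp (fun h => hA c h hm) (fun h => hB c h hm)
  | all A hA => intro n m c σ h hm; exact hA (shift c) h (hm.rename Nat.succ)

theorem Proper.rename {A : Ty} : ∀ (ξ : ℕ → ℕ), Proper A → Proper (rename ξ A) := by
  induction A with
  | var m => intros; trivial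
  | cst d => intros; trivial
  | arr A B hA hB => intro ξ h; exact ⟨hA ξ h.1, hB ξ h.2⟩
  | all A hA => intro ξ h; exact ⟨h.1.rename (upRen ξ), hA (upRen ξ) h.2⟩

theorem proper_upSub {σ : ℕ → Ty} (h : ∀ n, (σ n).Proper) : ∀ n, (upSub σ n).Proper
  | 0 => trivial
  | n + 1 => (h n).rename _

theorem proper_cons {C : Ty} {σ : ℕ → Ty} (hC : C.Proper) (h : ∀ n, (σ n).Proper) :
    ∀ n, (cons C σ n).Proper
  | 0 => hC
  | n + 1 => h n

theorem Proper.msub {A : Ty} : ∀ {c : Ty} {σ : ℕ → Ty},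
    Proper A → c.Proper → (∀ n, (σ n).Proper) → Proper (msub c σ A) := by
  induction A with
  | var m => intro c σ _ _ h; exact h m
  | cst d => intro c σ _ hc _; by_cases h : d = 0 <;> simp [Ty.msub, h, hc, Proper]
  | arr A B hA hB => intro c σ h hc hσ; exact ⟨hA h.1 hc hσ, hB h.2 hc hσ⟩
  | all A hA =>
    intro c σ h hc hσ
    exact ⟨h.1.msub (m := 0) _ rfl, hA h.2 (hc.rename _) (proper_upSub hσ)⟩

theorem Proper.inst {A C : Ty} (hA : A.Proper) (hC : C.Proper) : (A.inst C).Proper := by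
  rw [Ty.inst, subst_eq_msub]
  refine hA.msub trivial fun n => ?_
  cases n
  · exact hC
  · trivial

theorem msub_eq_subst_of_not_hasBot {A : Ty} : ∀ (c : Ty) (σ : ℕ → Ty), ¬ A.HasBot →
    msub c σ A = subst σ A := by
  induction A with
  | var n => intros; rfl
  | cst d => intro c σ h; exact if_neg h
  | arr A B hA hB =>
    intro c σ h
    simp only [msub, subst, hA c σ fun h' => h (Or.inl h'), hB c σ fun h' => h (Or.inr h')]
  | all A hA => intro c σ h; simp only [msub, subst, hA (shift c) (upSub σ) h]

/-! ### The Gödel translation and types ending with `⊥`. -/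

theorem star_rename (A : Ty) : ∀ ξ : ℕ → ℕ, star (rename ξ A) = rename ξ (star A) := by
  induction A with
  | var n => intros; rfl
  | cst d => intros; rfl
  | arr A B hA hB => intro ξ; simp only [rename, star, hA, hB]
  | all A hA => intro ξ; simp only [rename, star, hA]

theorem Free.star {A : Ty} : ∀ {n : ℕ}, Free n A → Free n A.star := by
  induction A with
  | var m => intro n h; exact Or.inl h
  | cst d => intro n h; exact h.elim
  | arr A B hA hB => intro n h; exact h.imp hA hB
  | all A hA => intro n h; exact hA (n := n + 1) h

theorem Proper.star {A : Ty} (h : Proper A) : Proper A.star := by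
  induction A with
  | var m => exact ⟨trivial, trivial⟩
  | cst d => exact ⟨trivial, trivial⟩
  | arr A B hA hB => exact ⟨hA h.1, hB h.2⟩
  | all A hA => exact ⟨h.1.star, hA h.2⟩

/-- Types of the form `A₁ → … → Aₙ → ⊥`, up to quantifiers. -/
inductive EndsBot : Ty → Prop
  | bot : EndsBot bot
  | arr {A B : Ty} : EndsBot B → EndsBot (arr A B)
  | all {A : Ty} : EndsBot A → EndsBot (all A)

/-- Every atom of `A`, in particular the last one, has been replaced by a negation, so the
instantiation `σ` plays no role. -/
theorem endsBot_star_msub (A : Ty) : ∀ σ : ℕ → Ty, EndsBot (msub bot σ A.star) := by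
  induction A with
  | var m => intro σ; exact .arr .bot
  | cst d => intro σ; exact .arr .bot
  | arr A B hA hB => intro σ; exact .arr (hB σ)
  | all A hA => intro σ; exact .all (hA _)

end Ty

/-! ### Substitution in terms -/

namespace Term

/-- The substitution sending `0` to `v` and `n + 1` to `σ n`. -/
def cons (v : Term) (σ : ℕ → Term) : ℕ → Term
  | 0 => v
  | n + 1 => σ n

theorem rename_rename (t : Term) : ∀ ξ ζ : ℕ → ℕ,
    rename ζ (rename ξ t) = rename (fun n => ζ (ξ n)) t := by
  induction t with
  | var n => intros; rfl
  | app u v hu hv => intro ξ ζ; simp only [rename, hu, hv]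
  | lam u hu =>
    intro ξ ζ
    simp only [rename, hu]
    congr 2; funext n; cases n <;> rfl

theorem subst_rename (t : Term) : ∀ (σ : ℕ → Term) (ξ : ℕ → ℕ),
    subst σ (rename ξ t) = subst (fun n => σ (ξ n)) t := by
  induction t with
  | var n => intros; rfl
  | app u v hu hv => intro σ ξ; simp only [rename, subst, hu, hv]
  | lam u hu =>
    intro σ ξ
    simp only [rename, subst, hu]
    congr 2; funext n; cases n <;> rfl

theorem rename_subst (t : Term) : ∀ (σ : ℕ → Term) (ξ : ℕ → ℕ),
    rename ξ (subst σ t) = subst (fun n => rename ξ (σ n)) t := by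
  induction t with
  | var n => intros; rfl
  | app u v hu hv => intro σ ξ; simp only [rename, subst, hu, hv]
  | lam u hu =>
    intro σ ξ
    simp only [rename, subst, hu]
    congr 2; funext n; cases n
    · rfl
    · simp only [upSub, rename_rename]; rfl

theorem subst_upSub_succ (t : Term) (σ : ℕ → Term) :
    subst (upSub σ) (rename Nat.succ t) = rename Nat.succ (subst σ t) := by
  simp only [subst_rename, rename_subst]; rfl

theorem subst_subst (t : Term) : ∀ σ τ : ℕ → Term,
    subst τ (subst σ t) = subst (fun n => subst τ (σ n)) t := by
  induction t with
  | var n => intros; rfl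
  | app u v hu hv => intro σ τ; simp only [subst, hu, hv]
  | lam u hu =>
    intro σ τ
    simp only [subst, hu]
    congr 2; funext n; cases n
    · rfl
    · exact subst_upSub_succ _ _

theorem upSub_var : upSub var = var := by funext n; cases n <;> rfl

theorem subst_var (t : Term) : subst var t = t := by
  induction t with
  | var n => rfl
  | app u v hu hv => simp only [subst, hu, hv]
  | lam u hu => simp only [subst, upSub_var, hu]

theorem rename_eq_subst (t : Term) (ξ : ℕ → ℕ) : rename ξ t = subst (fun n => var (ξ n)) t := by
  have h := subst_var (rename ξ t)
  rw [subst_rename] at h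
  exact h.symm

theorem inst_subst_upSub (u v : Term) (σ : ℕ → Term) :
    inst (subst (upSub σ) u) v = subst (cons v σ) u := by
  rw [inst, subst_subst]
  congr 1; funext n; cases n
  · rfl
  · simp only [upSub, subst_rename]; exact subst_var _

theorem subst_inst (u v : Term) (σ : ℕ → Term) :
    subst σ (inst u v) = inst (subst (upSub σ) u) (subst σ v) := by
  rw [inst_subst_upSub, inst, subst_subst]
  congr 1; funext n; cases n <;> rfl

theorem subst_congr (t : Term) : ∀ {σ τ : ℕ → Term}, (∀ n, Free n t → σ n = τ n) →
    subst σ t = subst τ t := by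
  induction t with
  | var n => intro σ τ h; exact h n rfl
  | app u v hu hv =>
    intro σ τ h
    simp only [subst, hu fun n hn => h n (Or.inl hn), hv fun n hn => h n (Or.inr hn)]
  | lam u hu =>
    intro σ τ h
    simp only [subst]
    refine congrArg _ (hu fun n hn => ?_)
    cases n
    · rfl
    · exact congrArg _ (h _ hn)

theorem Closed.subst {t : Term} (ht : t.Closed) (σ : ℕ → Term) : t.subst σ = t :=
  (subst_congr t fun n hn => (ht n hn).elim).trans (subst_var t)

/-! ### Reduction -/

/-- Beta-reduction in finitely many steps. -/
abbrev Betas : Term → Term → Prop := Relation.ReflTransGen Beta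

theorem Beta.subst {u v : Term} (h : Beta u v) :
    ∀ σ : ℕ → Term, Beta (u.subst σ) (v.subst σ) := by
  induction h with
  | redex u v => intro σ; rw [subst_inst]; exact .redex _ _
  | appL v _ ih => intro σ; exact .appL _ (ih σ)
  | appR u _ ih => intro σ; exact .appR _ (ih σ)
  | lam _ ih => intro σ; exact .lam (ih _)

theorem Betas.app {u u' v v' : Term} (hu : Betas u u') (hv : Betas v v') :
    Betas (app u v) (app u' v') :=
  (hu.lift (fun w => Term.app w v) fun _ _ h => .appL v h).trans
    (hv.lift (fun w => Term.app u' w) fun _ _ h => .appR u' h)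

theorem Betas.lam {u u' : Term} (h : Betas u u') : Betas (lam u) (lam u') :=
  h.lift Term.lam fun _ _ => .lam

theorem Betas.betaEq {u v : Term} (h : Betas u v) : BetaEq u v := by
  induction h with
  | refl => exact .refl _
  | tail _ h ih => exact .trans _ _ _ ih (.rel _ _ h)

theorem WHStep.beta {u v : Term} (h : WHStep u v) : Beta u v := by
  induction h with
  | redex u v => exact .redex u v
  | app v _ ih => exact .appL v ih

theorem WHStep.subst {u v : Term} (h : WHStep u v) (σ : ℕ → Term) :
    WHStep (u.subst σ) (v.subst σ) := by
  induction h with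
  | redex u v => rw [subst_inst]; exact .redex _ _
  | app v _ ih => exact .app _ ih

theorem WHRed.subst {u v : Term} (h : WHRed u v) (σ : ℕ → Term) :
    WHRed (u.subst σ) (v.subst σ) :=
  Relation.ReflTransGen.lift (Term.subst σ) (fun _ _ h => WHStep.subst h σ) _ _ h

theorem WHRed.app {u u' : Term} (h : WHRed u u') (v : Term) : WHRed (app u v) (app u' v) :=
  Relation.ReflTransGen.lift (fun w => Term.app w v) (fun _ _ h => WHStep.app v h) _ _ h

/-! ### Confluence -/

/-- Parallel reduction. -/
inductive Par : Term → Term → Prop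
  | var (n : ℕ) : Par (var n) (var n)
  | app {u u' v v' : Term} : Par u u' → Par v v' → Par (app u v) (app u' v')
  | lam {u u' : Term} : Par u u' → Par (lam u) (lam u')
  | redex {u u' v v' : Term} : Par u u' → Par v v' → Par (app (lam u) v) (inst u' v')

theorem Par.refl (t : Term) : Par t t := by
  induction t with
  | var n => exact .var n
  | app u v hu hv => exact .app hu hv
  | lam u hu => exact .lam hu

theorem Beta.par {u v : Term} (h : Beta u v) : Par u v := by
  induction h with
  | redex u v => exact .redex (.refl u) (.refl v)
  | appL v _ ih => exact .app ih (.refl v)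
  | appR u _ ih => exact .app (.refl u) ih
  | lam _ ih => exact .lam ih

theorem Par.betas {u v : Term} (h : Par u v) : Betas u v := by
  induction h with
  | var n => exact .refl
  | app _ _ hu hv => exact hu.app hv
  | lam _ hu => exact hu.lam
  | redex _ _ hu hv => exact (hu.lam.app hv).tail (.redex _ _)

theorem Par.rename {u v : Term} (h : Par u v) :
    ∀ ξ : ℕ → ℕ, Par (u.rename ξ) (v.rename ξ) := by
  induction h with
  | var n => intro ξ; exact .var _
  | app _ _ hu hv => intro ξ; exact .app (hu ξ) (hv ξ)
  | lam _ hu => intro ξ; exact .lam (hu _)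
  | @redex u u' v v' _ _ hu hv =>
    intro ξ
    have h := Par.redex (hu (upRen ξ)) (hv ξ)
    have e : inst (u'.rename (upRen ξ)) (v'.rename ξ) = (inst u' v').rename ξ := by
      simp only [inst, subst_rename, rename_subst]
      congr 1; funext n; cases n <;> rfl
    rw [e] at h; exact h

theorem Par.upSub {σ τ : ℕ → Term} (h : ∀ n, Par (σ n) (τ n)) :
    ∀ n, Par (upSub σ n) (upSub τ n)
  | 0 => .var 0
  | n + 1 => (h n).rename _

theorem Par.subst {u v : Term} (h : Par u v) : ∀ {σ τ : ℕ → Term}, (∀ n, Par (σ n) (τ n)) →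
    Par (u.subst σ) (v.subst τ) := by
  induction h with
  | var n => intro σ τ h; exact h n
  | app _ _ hu hv => intro σ τ h; exact .app (hu h) (hv h)
  | lam _ hu => intro σ τ h; exact .lam (hu (Par.upSub h))
  | redex _ _ hu hv =>
    intro σ τ h; rw [subst_inst]; exact .redex (hu (Par.upSub h)) (hv h)

theorem Par.inst {u u' v v' : Term} (hu : Par u u') (hv : Par v v') :
    Par (inst u v) (inst u' v') :=
  hu.subst fun n => by
    cases n
    · exact hv
    · exact .var _

/-- The complete development of a term. -/
def develop : Term → Term
  | var n => var n
  | lam u => lam (develop u)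
  | app (lam u) v => inst (develop u) (develop v)
  | app (var n) v => app (var n) (develop v)
  | app (app s t) v => app (develop (app s t)) (develop v)

/-- Takahashi's triangle property: contracting all redexes of `u` at once absorbs any parallel step,
so parallel reduction has the diamond property. -/
theorem Par.develop {u v : Term} (h : Par u v) : Par v (develop u) := by
  induction h with
  | var n => exact .var n
  | lam _ hu => exact .lam hu
  | redex _ _ hu hv => exact hu.inst hv
  | @app u u' v v' h _ hu hv =>
    cases u with
    | var n => exact .app hu hv
    | app s t => exact .app hu hv
    | lam s =>
      cases h with
      | lam h =>
        cases hu with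
        | lam hu => exact .redex hu hv

theorem par_iff_betas {u v : Term} : Relation.ReflTransGen Par u v ↔ Betas u v := by
  constructor
  · intro h
    induction h with
    | refl => exact .refl
    | tail _ h ih => exact ih.trans h.betas
  · exact fun h => Relation.ReflTransGen.mono (fun _ _ h => Beta.par h) _ _ h

theorem BetaEq.join {u v : Term} (h : BetaEq u v) : Relation.Join Betas u v := by
  have cr : ∀ a b c : Term, Par a b → Par a c →
      ∃ d, Relation.ReflGen Par b d ∧ Relation.ReflTransGen Par c d :=
    fun a _ _ hb hc => ⟨Term.develop a, .single hb.develop, .single hc.develop⟩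
  have e := Relation.equivalence_join_reflTransGen cr
  have key : Relation.Join (Relation.ReflTransGen Par) u v := by
    induction h with
    | rel a b h => exact ⟨b, .single h.par, .refl⟩
    | refl a => exact e.refl a
    | symm a b _ ih => exact e.symm ih
    | trans a b c _ _ h1 h2 => exact e.trans h1 h2
  obtain ⟨w, h1, h2⟩ := key
  exact ⟨w, par_iff_betas.1 h1, par_iff_betas.1 h2⟩

theorem Normal.eq_of_betas {u v : Term} (hu : u.Normal) (h : Betas u v) : v = u := by
  induction h with
  | refl => rfl
  | tail _ h ih => subst ih; exact (hu _ h).elim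

theorem BetaEq.betas_of_normal {u v : Term} (h : BetaEq u v) (hv : v.Normal) : Betas u v := by
  obtain ⟨w, h1, h2⟩ := h.join
  rw [hv.eq_of_betas h2] at h1
  exact h1

/-! ### Standard reduction -/

/-- Standard reductions: weak head reduction, followed by standard reductions of the subterms. -/
inductive Std : Term → Term → Prop
  | var {t : Term} {n : ℕ} : WHRed t (var n) → Std t (var n)
  | app {t a b u v : Term} : WHRed t (app a b) → Std a u → Std b v → Std t (app u v)
  | lam {t a u : Term} : WHRed t (lam a) → Std a u → Std t (lam u)

theorem Std.refl (t : Term) : Std t t := by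
  induction t with
  | var n => exact .var .refl
  | app u v hu hv => exact .app .refl hu hv
  | lam u hu => exact .lam .refl hu

theorem Std.head {s t u : Term} (h : WHRed s t) (ht : Std t u) : Std s u := by
  cases ht with
  | var h' => exact .var (h.trans h')
  | app h' h1 h2 => exact .app (h.trans h') h1 h2
  | lam h' h1 => exact .lam (h.trans h') h1

theorem Std.rename {t u : Term} (h : Std t u) :
    ∀ ξ : ℕ → ℕ, Std (t.rename ξ) (u.rename ξ) := by
  have w : ∀ {a b : Term} (ξ : ℕ → ℕ), WHRed a b → WHRed (a.rename ξ) (b.rename ξ) := by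
    intro a b ξ h; rw [rename_eq_subst, rename_eq_subst]; exact h.subst _
  induction h with
  | var h => intro ξ; exact .var (w ξ h)
  | app h _ _ h1 h2 => intro ξ; exact .app (w ξ h) (h1 ξ) (h2 ξ)
  | lam h _ h1 => intro ξ; exact .lam (w ξ h) (h1 _)

theorem Std.subst {t u : Term} (h : Std t u) : ∀ {σ τ : ℕ → Term}, (∀ n, Std (σ n) (τ n)) →
    Std (t.subst σ) (u.subst τ) := by
  induction h with
  | @var t n h => intro σ τ hσ; exact .head (h.subst σ) (hσ n)
  | app h _ _ h1 h2 => intro σ τ hσ; exact .app (h.subst σ) (h1 hσ) (h2 hσ)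
  | lam h _ h1 =>
    intro σ τ hσ
    refine .lam (h.subst σ) (h1 fun n => ?_)
    cases n
    · exact .refl _
    · exact (hσ _).rename _

/-- A redex of `u` comes from one that a weak head reduction uncovers at the same place, so its
contraction can be moved into that reduction. -/
theorem Std.tail {u v : Term} (h : Beta u v) : ∀ {t : Term}, Std t u → Std t v := by
  induction h with
  | redex u v =>
    intro t ht
    cases ht with
    | app h h1 h2 =>
      cases h1 with
      | lam h' h1 =>
        refine .head ((h.trans (h'.app _)).tail (.redex _ _)) (h1.subst fun n => ?_)
        cases n
        · exact h2
        · exact .refl _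
  | appL v _ ih => intro t ht; cases ht with | app h h1 h2 => exact .app h (ih h1) h2
  | appR u _ ih => intro t ht; cases ht with | app h h1 h2 => exact .app h h1 (ih h2)
  | lam _ ih => intro t ht; cases ht with | lam h h1 => exact .lam h (ih h1)

/-- The standardization theorem. -/
theorem Betas.std {u v : Term} (h : Betas u v) : Std u v := by
  induction h with
  | refl => exact .refl _
  | tail _ h ih => exact ih.tail h

end Term

open Term (Beta Betas Normal)

/-! ### Structural properties of typing -/

theorem Ty.Proper.of_shift {A : Ty} (h : A.shift.Proper) : A.Proper := by
  have := h.inst (C := Ty.var 0) trivial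
  rwa [Ty.inst_shift] at this

theorem map_shift_proper {Γ : List Ty} : (∀ B ∈ Γ.map Ty.shift, B.Proper) ↔ ∀ B ∈ Γ, B.Proper := by
  constructor
  · exact fun h B hB => (h _ (List.mem_map_of_mem hB)).of_shift
  · intro h B hB
    obtain ⟨A, hA, rfl⟩ := List.mem_map.1 hB
    exact (h A hA).rename _

theorem TypF.ctx_proper {Γ : List Ty} {t : Term} {A : Ty} (h : TypF Γ t A) :
    ∀ B ∈ Γ, B.Proper := by
  induction h with
  | ax h _ => exact h
  | arrI _ ih => exact fun B hB => ih B (List.mem_cons_of_mem _ hB)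
  | arrE _ _ ih _ => exact ih
  | allI _ _ ih => exact map_shift_proper.1 ih
  | allE _ _ ih => exact ih

theorem TypF.proper {Γ : List Ty} {t : Term} {A : Ty} (h : TypF Γ t A) : A.Proper := by
  induction h with
  | ax h hi => exact h _ (List.mem_of_getElem? hi)
  | arrI h ih => exact ⟨h.ctx_proper _ List.mem_cons_self, ih⟩
  | arrE _ _ ih _ => exact ih.2
  | allI _ h ih => exact ⟨h, ih⟩
  | allE _ hC ih => exact ih.2.inst hC

theorem cons_proper {Γ : List Ty} {A : Ty} (hA : A.Proper) (h : ∀ B ∈ Γ, B.Proper) :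
    ∀ B ∈ A :: Γ, B.Proper := List.forall_mem_cons.2 ⟨hA, h⟩

theorem map_msub_proper {Γ : List Ty} {c : Ty} {σ : ℕ → Ty} (h : ∀ B ∈ Γ, B.Proper)
    (hc : c.Proper) (hσ : ∀ n, (σ n).Proper) : ∀ B ∈ Γ.map (Ty.msub c σ), B.Proper := by
  intro B hB
  obtain ⟨A, hA, rfl⟩ := List.mem_map.1 hB
  exact (h A hA).msub hc hσ

theorem map_shift_msub (Γ : List Ty) (c : Ty) (σ : ℕ → Ty) :
    (Γ.map Ty.shift).map (Ty.msub c.shift (Ty.upSub σ)) = (Γ.map (Ty.msub c σ)).map Ty.shift := by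
  simp only [List.map_map]
  exact List.map_congr_left fun A _ => Ty.msub_shift A c σ

theorem TypF.msub {Γ : List Ty} {t : Term} {A : Ty} (h : TypF Γ t A) :
    ∀ {c : Ty} {σ : ℕ → Ty}, c.Proper → (∀ n, (σ n).Proper) →
      TypF (Γ.map (Ty.msub c σ)) t (Ty.msub c σ A) := by
  induction h with
  | ax h hi =>
    intro c σ hc hσ
    exact .ax (map_msub_proper h hc hσ) (by rw [List.getElem?_map, hi]; rfl)
  | arrI _ ih => intro c σ hc hσ; exact .arrI (ih hc hσ)
  | arrE _ _ ih1 ih2 => intro c σ hc hσ; exact .arrE (ih1 hc hσ) (ih2 hc hσ)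
  | allI _ h ih =>
    intro c σ hc hσ
    refine .allI ?_ (h.msub (m := 0) _ rfl)
    rw [← map_shift_msub]
    exact ih (hc.rename _) (Ty.proper_upSub hσ)
  | allE _ hC ih =>
    intro c σ hc hσ
    rw [Ty.msub_inst]
    exact .allE (ih hc hσ) (hC.msub hc hσ)

theorem TypF.shift {Γ : List Ty} {t : Term} {A : Ty} (h : TypF Γ t A) :
    TypF (Γ.map Ty.shift) t A.shift := by
  have e : Ty.shift = Ty.msub Ty.bot fun n => Ty.var (n + 1) := by
    funext B; rw [Ty.shift, Ty.rename_eq_subst, Ty.subst_eq_msub]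
  rw [e]
  exact h.msub trivial fun _ => trivial

theorem map_msub_single (Γ : List Ty) (C : Ty) :
    (Γ.map Ty.shift).map (Ty.msub Ty.bot (Ty.single C)) = Γ := by
  rw [List.map_map]
  refine (List.map_congr_left fun A _ => ?_).trans (List.map_id Γ)
  simp only [Function.comp_apply, ← Ty.subst_eq_msub, id]
  exact Ty.inst_shift A C

theorem proper_single {C : Ty} (hC : C.Proper) : ∀ n, (Ty.single C n).Proper
  | 0 => hC
  | _ + 1 => trivial

theorem getElem?_map_shift {Γ Δ : List Ty} {i j : ℕ} {B : Ty}
    (H : ∀ B, Γ[i]? = some B → Δ[j]? = some B) (h : (Γ.map Ty.shift)[i]? = some B) :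
    (Δ.map Ty.shift)[j]? = some B := by
  rw [List.getElem?_map, Option.map_eq_some_iff] at h ⊢
  obtain ⟨A, hA, rfl⟩ := h
  exact ⟨A, H A hA, rfl⟩

/-- Only the free variables are constrained, so this yields strengthening as well as weakening: a
closed term can be moved to the empty context. -/
theorem TypF.rename {Γ : List Ty} {t : Term} {A : Ty} (h : TypF Γ t A) :
    ∀ {Δ : List Ty} (ξ : ℕ → ℕ), (∀ B ∈ Δ, B.Proper) →
      (∀ i B, t.Free i → Γ[i]? = some B → Δ[ξ i]? = some B) → TypF Δ (t.rename ξ) A := by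
  induction h with
  | ax _ hi => intro Δ ξ hΔ H; exact .ax hΔ (H _ _ rfl hi)
  | arrI h ih =>
    intro Δ ξ hΔ H
    refine .arrI (ih _ (cons_proper (h.ctx_proper _ List.mem_cons_self) hΔ) fun i B hf hi => ?_)
    cases i with
    | zero => exact hi
    | succ i => exact H i B hf hi
  | arrE _ _ ih1 ih2 =>
    intro Δ ξ hΔ H
    exact .arrE (ih1 ξ hΔ fun i B hf => H i B (Or.inl hf))
      (ih2 ξ hΔ fun i B hf => H i B (Or.inr hf))
  | allI _ h ih =>
    intro Δ ξ hΔ H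
    exact .allI (ih ξ (map_shift_proper.2 hΔ) fun i B hf hi =>
      getElem?_map_shift (fun B => H i B hf) hi) h
  | allE _ hC ih => intro Δ ξ hΔ H; exact .allE (ih ξ hΔ H) hC

theorem TypF.change {Γ Δ : List Ty} {t : Term} {A : Ty} (h : TypF Γ t A)
    (hΔ : ∀ B ∈ Δ, B.Proper) (H : ∀ i B, t.Free i → Γ[i]? = some B → Δ[i]? = some B) :
    TypF Δ t A := by
  have := h.rename id hΔ H
  rwa [Term.rename_eq_subst, show (fun n => Term.var (id n)) = Term.var from rfl,
    Term.subst_var] at this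

theorem getElem?_append_of_eq_some {Γ : List Ty} (Δ : List Ty) {i : ℕ} {B : Ty}
    (h : Γ[i]? = some B) : (Γ ++ Δ)[i]? = some B := by
  rw [List.getElem?_append_left (List.getElem?_eq_some_iff.1 h).1, h]

theorem TypF.append {Γ Δ : List Ty} {t : Term} {A : Ty} (h : TypF Γ t A)
    (hΔ : ∀ B ∈ Δ, B.Proper) : TypF (Γ ++ Δ) t A :=
  h.change (fun B hB => (List.mem_append.1 hB).elim (h.ctx_proper B) (hΔ B))
    fun _ _ _ hi => getElem?_append_of_eq_some Δ hi

theorem TypF.subst {Γ : List Ty} {t : Term} {A : Ty} (h : TypF Γ t A) :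
    ∀ {Δ : List Ty} {η : ℕ → Term}, (∀ B ∈ Δ, B.Proper) →
      (∀ i B, Γ[i]? = some B → TypF Δ (η i) B) → TypF Δ (t.subst η) A := by
  induction h with
  | ax _ hi => intro Δ η _ H; exact H _ _ hi
  | @arrI Γ t B C h ih =>
    intro Δ η hΔ H
    have hp := cons_proper (h.ctx_proper _ List.mem_cons_self) hΔ
    refine .arrI (ih hp fun i B' hi => ?_)
    cases i with
    | zero => exact .ax hp hi
    | succ i => exact (H i B' hi).rename _ hp fun _ _ _ hj => hj
  | arrE _ _ ih1 ih2 => intro Δ η hΔ H; exact .arrE (ih1 hΔ H) (ih2 hΔ H)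
  | allI _ h ih =>
    intro Δ η hΔ H
    refine .allI (ih (map_shift_proper.2 hΔ) fun i B hi => ?_) h
    rw [List.getElem?_map, Option.map_eq_some_iff] at hi
    obtain ⟨A, hA, rfl⟩ := hi
    exact (H i A hA).shift
  | allE _ hC ih => intro Δ η hΔ H; exact .allE (ih hΔ H) hC

theorem TypF.lt_length {Γ : List Ty} {t : Term} {A : Ty} (h : TypF Γ t A) :
    ∀ {i : ℕ}, t.Free i → i < Γ.length := by
  induction h with
  | ax _ hi => intro j hj; cases hj; exact (List.getElem?_eq_some_iff.1 hi).1
  | arrI _ ih => intro j hj; exact Nat.lt_of_succ_lt_succ (ih hj)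
  | arrE _ _ ih1 ih2 => intro j hj; exact hj.elim ih1 ih2
  | allI _ _ ih => intro j hj; have := ih hj; rwa [List.length_map] at this
  | allE _ _ ih => exact ih

theorem TypF.closed {t : Term} {A : Ty} (h : TypF [] t A) : t.Closed :=
  fun _ hn => absurd (h.lt_length hn) (Nat.not_lt_zero _)

/-! ### Subject reduction -/

/-- `λ u` can be typed with `A` by introduction rules only, after the typing of `u`. -/
def LamTyp : List Ty → Term → Ty → Prop
  | _, _, .var _ => False
  | _, _, .cst _ => False
  | Γ, u, .arr B C => TypF (B :: Γ) u C
  | Γ, u, .all A => LamTyp (Γ.map Ty.shift) u A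

theorem LamTyp.msub {A : Ty} : ∀ {Γ : List Ty} {u : Term} {σ : ℕ → Ty}, LamTyp Γ u A →
    (∀ n, (σ n).Proper) → LamTyp (Γ.map (Ty.msub Ty.bot σ)) u (Ty.msub Ty.bot σ A) := by
  induction A with
  | var n => intro Γ u σ h; exact h.elim
  | cst d => intro Γ u σ h; exact h.elim
  | arr B C _ _ => intro Γ u σ h hσ; exact TypF.msub h trivial hσ
  | all A ih =>
    intro Γ u σ h hσ
    have := ih h (Ty.proper_upSub hσ)
    rwa [show Ty.bot = Ty.bot.shift from rfl, map_shift_msub] at this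

/-- The generation lemma for abstractions. Eliminations of ∀ are absorbed because `LamTyp` is stable
under type substitution. -/
theorem TypF.lamTyp {Γ : List Ty} {t : Term} {A : Ty} (h : TypF Γ t A) :
    ∀ {u : Term}, t = .lam u → LamTyp Γ u A := by
  induction h with
  | ax => intro u e; cases e
  | arrI h => intro u e; cases e; exact h
  | arrE => intro u e; cases e
  | allI _ _ ih => intro u e; exact ih e
  | @allE Γ t A C _ hC ih =>
    intro u e
    have h : LamTyp (Γ.map Ty.shift) u A := ih e
    have := h.msub (proper_single hC)
    rwa [map_msub_single, ← Ty.subst_eq_msub] at this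

theorem TypF.inst {Γ : List Ty} {u v : Term} {B C : Ty} (hu : TypF (B :: Γ) u C)
    (hv : TypF Γ v B) : TypF Γ (u.inst v) C := by
  refine hu.subst hv.ctx_proper fun i A hi => ?_
  cases i with
  | zero => cases hi; exact hv
  | succ i => exact .ax hv.ctx_proper hi

theorem TypF.beta {Γ : List Ty} {t : Term} {A : Ty} (h : TypF Γ t A) :
    ∀ {t' : Term}, Beta t t' → TypF Γ t' A := by
  induction h with
  | ax => intro t' h; cases h
  | arrI _ ih => intro t' h; cases h with | lam h => exact .arrI (ih h)
  | arrE h1 h2 ih1 ih2 =>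
    intro t' h
    cases h with
    | redex u v => exact TypF.inst (h1.lamTyp rfl) h2
    | appL v h => exact .arrE (ih1 h) h2
    | appR u h => exact .arrE h1 (ih2 h)
  | allI _ h ih => intro t' ht; exact .allI (ih ht) h
  | allE _ hC ih => intro t' ht; exact .allE (ih ht) hC

theorem TypF.betas {Γ : List Ty} {t t' : Term} {A : Ty} (h : TypF Γ t A) (ht : Betas t t') :
    TypF Γ t' A := by
  induction ht with
  | refl => exact h
  | tail _ hb ih => exact ih.beta hb

/-! ### The Gödel translation of F₀ derivations -/

/-- ∀-elimination would not survive the translation: `A[C/X]*` has `C*` in the places where an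
instance of `A*` has a negation. -/
theorem TypF₀.star {Γ : List Ty} {t : Term} {A : Ty} (h : TypF₀ Γ t A) :
    TypF (Γ.map Ty.star) t A.star := by
  induction h with
  | ax h hi =>
    refine .ax (fun B hB => ?_) (by rw [List.getElem?_map, hi]; rfl)
    obtain ⟨A, hA, rfl⟩ := List.mem_map.1 hB
    exact (h A hA).star
  | arrI _ ih => exact .arrI ih
  | arrE _ _ ih1 ih2 => exact .arrE ih1 ih2
  | @allI Γ t A _ h ih =>
    refine .allI ?_ h.star
    rw [List.map_map] at ih ⊢
    refine (List.map_congr_left fun B _ => ?_ : _ = _) ▸ ih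
    exact Ty.star_rename B _

theorem TypF₀.toTypF {Γ : List Ty} {t : Term} {A : Ty} (h : TypF₀ Γ t A) : TypF Γ t A := by
  induction h with
  | ax h hi => exact .ax h hi
  | arrI _ ih => exact .arrI ih
  | arrE _ _ ih1 ih2 => exact .arrE ih1 ih2
  | allI _ h ih => exact .allI ih h

/-! ### Typing of applications to several arguments -/

/-- Application to a list of arguments. -/
def Term.apps : Term → List Term → Term := List.foldl Term.app

theorem Term.apps_append (t : Term) (l : List Term) (a : Term) :
    t.apps (l ++ [a]) = Term.app (t.apps l) a := by
  simp [Term.apps]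

theorem Term.exists_apps (t : Term) :
    (∃ i l, t = (Term.var i).apps l) ∨ ∃ u l, t = (Term.lam u).apps l := by
  induction t with
  | var n => exact Or.inl ⟨n, [], rfl⟩
  | lam u => exact Or.inr ⟨u, [], rfl⟩
  | app u v hu _ =>
    rcases hu with ⟨i, l, rfl⟩ | ⟨w, l, rfl⟩
    · exact Or.inl ⟨i, l ++ [v], (Term.apps_append _ _ _).symm⟩
    · exact Or.inr ⟨w, l ++ [v], (Term.apps_append _ _ _).symm⟩

theorem Term.apps_subst (l : List Term) : ∀ (t : Term) (σ : ℕ → Term),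
    (t.apps l).subst σ = (t.subst σ).apps (l.map (Term.subst σ)) := by
  induction l with
  | nil => intros; rfl
  | cons a l ih => intro t σ; exact ih (t.app a) σ

theorem Term.WHStep.apps {t t' : Term} (h : Term.WHStep t t') (l : List Term) :
    Term.WHStep (t.apps l) (t'.apps l) := by
  induction l generalizing t t' with
  | nil => exact h
  | cons a l ih => exact ih (.app a h)

theorem Term.WHRed.apps {t t' : Term} (h : Term.WHRed t t') (l : List Term) :
    Term.WHRed (t.apps l) (t'.apps l) :=
  Relation.ReflTransGen.lift (fun w => Term.apps w l) (fun _ _ h => Term.WHStep.apps h l) _ _ h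

/-- A head of type `A`, applied to the arguments, has the type `F`. -/
inductive Spine (Γ : List Ty) : Ty → List Term → Ty → Prop
  | nil (A : Ty) : Spine Γ A [] A
  | inst {A C F : Ty} {l : List Term} : C.Proper → Spine Γ (A.inst C) l F → Spine Γ (.all A) l F
  | app {B C F : Ty} {a : Term} {l : List Term} :
      TypF Γ a B → Spine Γ C l F → Spine Γ (.arr B C) (a :: l) F

theorem Spine.msub {Γ : List Ty} {A F : Ty} {l : List Term} {σ : ℕ → Ty} (h : Spine Γ A l F)
    (hσ : ∀ n, (σ n).Proper) :
    Spine (Γ.map (Ty.msub Ty.bot σ)) (Ty.msub Ty.bot σ A) l (Ty.msub Ty.bot σ F) := by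
  induction h with
  | nil A => exact .nil _
  | inst hC _ ih =>
    rw [Ty.msub_inst] at ih
    exact .inst (hC.msub (c := Ty.bot) trivial hσ) ih
  | app ha _ ih => exact .app (ha.msub trivial hσ) ih

theorem Spine.shift {Γ : List Ty} {A F : Ty} {l : List Term} (h : Spine Γ A l F) :
    Spine (Γ.map Ty.shift) A.shift l F.shift := by
  have e : Ty.shift = Ty.msub Ty.bot fun n => Ty.var (n + 1) := by
    funext B; rw [Ty.shift, Ty.rename_eq_subst, Ty.subst_eq_msub]
  rw [e]
  exact h.msub fun _ => trivial

theorem Spine.trans {Γ : List Ty} {A B F : Ty} {l m : List Term} (h : Spine Γ A l B)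
    (h' : Spine Γ B m F) : Spine Γ A (l ++ m) F := by
  induction h with
  | nil A => exact h'
  | inst hC _ ih => exact .inst hC (ih h')
  | app ha _ ih => exact .app ha (ih h')

theorem Spine.typF {Γ : List Ty} {A F : Ty} {l : List Term} (h : Spine Γ A l F) :
    ∀ {t : Term}, TypF Γ t A → TypF Γ (t.apps l) F := by
  induction h with
  | nil A => intro t ht; exact ht
  | inst hC _ ih => intro t ht; exact ih (.allE ht hC)
  | app ha _ ih => intro t ht; exact ih (.arrE ht ha)

theorem Spine.append {Γ Δ : List Ty} {A F : Ty} {l : List Term} (h : Spine Γ A l F)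
    (hΔ : ∀ B ∈ Δ, B.Proper) : Spine (Γ ++ Δ) A l F := by
  induction h with
  | nil A => exact .nil _
  | inst hC _ ih => exact .inst hC ih
  | app ha _ ih => exact .app (ha.append hΔ) ih

/-- `Spine`, up to introductions of the outermost quantifiers of the last type. -/
def GenSpine : List Ty → Ty → List Term → Ty → Prop
  | Γ, A, l, .all F => GenSpine (Γ.map Ty.shift) A.shift l F
  | Γ, A, l, F => Spine Γ A l F

/-- A quantified target is opened by instantiating it, after a shift, with its own bound variable.
-/
theorem Spine.gen {F : Ty} : ∀ {Γ : List Ty} {A : Ty} {l : List Term}, Spine Γ A l F →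
    GenSpine Γ A l F := by
  induction F with
  | var n => intro Γ A l h; exact h
  | cst d => intro Γ A l h; exact h
  | arr B C _ _ => intro Γ A l h; exact h
  | all F ih =>
    intro Γ A l h
    refine ih ?_
    have h0 : Spine (Γ.map Ty.shift) (Ty.shift (.all F)) [] F := by
      refine .inst (C := .var 0) trivial ?_
      rw [Ty.inst_var_zero]
      exact .nil F
    simpa using h.shift.trans h0

theorem GenSpine.msub {F : Ty} : ∀ {Γ : List Ty} {A : Ty} {l : List Term} {σ : ℕ → Ty},
    GenSpine Γ A l F → (∀ n, (σ n).Proper) →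
    GenSpine (Γ.map (Ty.msub Ty.bot σ)) (Ty.msub Ty.bot σ A) l (Ty.msub Ty.bot σ F) := by
  induction F with
  | var n => intro Γ A l σ h hσ; exact (Spine.msub h hσ).gen
  | cst d => intro Γ A l σ h hσ; exact (Spine.msub h hσ).gen
  | arr B C _ _ => intro Γ A l σ h hσ; exact (Spine.msub h hσ).gen
  | all F ih =>
    intro Γ A l σ h hσ
    have := ih h (Ty.proper_upSub hσ)
    rwa [show Ty.bot = Ty.bot.shift from rfl, map_shift_msub, Ty.msub_shift] at this

/-- Generation for terms headed by a variable. Introduced quantifiers stay generic in `GenSpine`, so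
that a later elimination is just a substitution (`GenSpine.msub`). -/
theorem TypF.genSpine {Γ : List Ty} {t : Term} {F : Ty} (h : TypF Γ t F) :
    ∀ {i : ℕ} {A : Ty} {l : List Term}, t = (Term.var i).apps l → Γ[i]? = some A →
      GenSpine Γ A l F := by
  induction h with
  | @ax Γ j B _ hi =>
    intro i A l e hA
    rcases List.eq_nil_or_concat l with rfl | ⟨l, a, rfl⟩
    · cases e
      rw [hi] at hA; cases hA
      exact (Spine.nil _).gen
    · rw [List.concat_eq_append, Term.apps_append] at e; cases e
  | arrI _ _ =>
    intro i A l e hA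
    rcases List.eq_nil_or_concat l with rfl | ⟨l, a, rfl⟩
    · cases e
    · rw [List.concat_eq_append, Term.apps_append] at e; cases e
  | arrE _ hv ih _ =>
    intro i A l e hA
    rcases List.eq_nil_or_concat l with rfl | ⟨l, a, rfl⟩
    · cases e
    · rw [List.concat_eq_append, Term.apps_append] at e; cases e
      rw [List.concat_eq_append]
      exact (Spine.trans (ih rfl hA) (.app hv (.nil _))).gen
  | allI _ _ ih =>
    intro i A l e hA
    exact ih e (by rw [List.getElem?_map, hA]; rfl)
  | @allE Γ t F C _ hC ih =>
    intro i A l e hA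
    have h : GenSpine (Γ.map Ty.shift) A.shift l F := ih e hA
    have := h.msub (proper_single hC)
    rwa [map_msub_single, ← Ty.subst_eq_msub, ← Ty.subst_eq_msub,
      show Ty.subst (Ty.single C) A.shift = A from Ty.inst_shift A C] at this

/-! ### Strong normalization -/

namespace Term

/-- Strong normalization. -/
def SN (t : Term) : Prop := Acc (fun a b => Beta b a) t

theorem SN.beta {t t' : Term} (h : SN t) (ht : Beta t t') : SN t' := h.inv ht

theorem SN.exists_normal {t : Term} (h : SN t) : ∃ w, Betas t w ∧ w.Normal := by
  induction h with
  | intro t _ ih =>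
    by_cases hn : t.Normal
    · exact ⟨t, .refl, hn⟩
    · simp only [Normal, not_forall, not_not] at hn
      obtain ⟨u, hu⟩ := hn
      obtain ⟨w, hw, hn⟩ := ih u hu
      exact ⟨w, .head hu hw, hn⟩

/-- Terms that are not abstractions. -/
def Neutral : Term → Prop
  | lam _ => False
  | _ => True

/-- Reducibility candidates. -/
structure Candidate (S : Set Term) : Prop where
  sn : ∀ {t}, t ∈ S → SN t
  beta : ∀ {t t'}, t ∈ S → Beta t t' → t' ∈ S
  neutral : ∀ {t}, Neutral t → (∀ t', Beta t t' → t' ∈ S) → t ∈ S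

theorem candidate_SN : Candidate {t | SN t} where
  sn h := h
  beta h h' := SN.beta h h'
  neutral _ h := Acc.intro _ h

theorem Candidate.var {S : Set Term} (h : Candidate S) (n : ℕ) : var n ∈ S :=
  h.neutral trivial fun _ h => nomatch h

/-- The terms that map `S` to `S'`. -/
def arrow (S S' : Set Term) : Set Term := {t | ∀ v ∈ S, app t v ∈ S'}

theorem SN.of_app {u v : Term} (h : SN (app u v)) : SN u := by
  generalize e : app u v = t at h
  induction h generalizing u with
  | intro t _ ih => subst e; exact Acc.intro _ fun u' hu => ih _ (.appL v hu) rfl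

theorem SN.of_inst {u v : Term} (h : SN (inst u v)) : SN u := by
  generalize e : inst u v = t at h
  induction h generalizing u with
  | intro t _ ih => subst e; exact Acc.intro _ fun u' hu => ih _ (hu.subst _) rfl

theorem Candidate.arrow {S S' : Set Term} (h : Candidate S) (h' : Candidate S') :
    Candidate (arrow S S') where
  sn ht := (h'.sn (ht _ (h.var 0))).of_app
  beta ht hb v hv := h'.beta (ht v hv) (.appL v hb)
  neutral := by
    intro t hn ht v hv
    have := h.sn hv
    induction this with
    | intro v _ ih =>
      refine h'.neutral trivial fun w hw => ?_
      cases hw with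
      | redex => exact hn.elim
      | appL _ hb => exact ht _ hb v hv
      | appR _ hb => exact ih _ hb (h.beta hv hb)

/-- The application of `lam u` to `v` is neutral, and its reducts come from its contraction or from
a step in `u` or `v`; hence the nested inductions on the strong normalization of both. -/
theorem lam_mem_arrow {S S' : Set Term} (h : Candidate S) (h' : Candidate S') {u : Term}
    (hu : ∀ v ∈ S, inst u v ∈ S') : lam u ∈ Term.arrow S S' := by
  have hsn : SN u := (h'.sn (hu _ (h.var 0))).of_inst
  induction hsn with
  | intro u _ ihu =>
    intro v hv
    have := h.sn hv
    induction this with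
    | intro v _ ihv =>
      refine h'.neutral trivial fun w hw => ?_
      cases hw with
      | redex => exact hu v hv
      | appL _ hb =>
        cases hb with
        | lam hb => exact ihu _ hb (fun v hv => h'.beta (hu v hv) (hb.subst _)) v hv
      | appR _ hb => exact ihv _ hb (h.beta hv hb)

end Term

open Term (SN Candidate)

/-- The interpretation of types by reducibility candidates. -/
def interp : (ℕ → Set Term) → Ty → Set Term
  | ρ, .var n => ρ n
  | _, .cst _ => {t | SN t}
  | ρ, .arr A B => Term.arrow (interp ρ A) (interp ρ B)
  | ρ, .all A => {t | ∀ S, Candidate S → t ∈ interp (fun n => n.casesOn S ρ) A}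

theorem candidate_interp {A : Ty} : ∀ {ρ : ℕ → Set Term}, (∀ n, Candidate (ρ n)) →
    Candidate (interp ρ A) := by
  induction A with
  | var n => intro ρ h; exact h n
  | cst d => intro ρ _; exact Term.candidate_SN
  | arr A B hA hB => intro ρ h; exact (hA h).arrow (hB h)
  | all A hA =>
    intro ρ h
    have key : ∀ S, Candidate S → Candidate (interp (fun n => n.casesOn S ρ) A) := fun S hS =>
      hA fun n => by cases n; exacts [hS, h _]
    exact
      { sn := fun ht => (key _ Term.candidate_SN).sn (ht _ Term.candidate_SN)
        beta := fun ht hb S hS => (key S hS).beta (ht S hS) hb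
        neutral := fun hn ht S hS => (key S hS).neutral hn fun t' hb => ht t' hb S hS }

theorem interp_rename {A : Ty} : ∀ {ρ : ℕ → Set Term} {ξ : ℕ → ℕ},
    interp ρ (A.rename ξ) = interp (fun n => ρ (ξ n)) A := by
  induction A with
  | var n => intros; rfl
  | cst d => intros; rfl
  | arr A B hA hB => intro ρ ξ; simp only [interp, Ty.rename, hA, hB]
  | all A hA =>
    intro ρ ξ
    simp only [interp, Ty.rename, hA]
    have : ∀ S : Set Term, (fun n => (Ty.upRen ξ n).casesOn S ρ : ℕ → Set Term) =
        fun n => n.casesOn S fun n => ρ (ξ n) := by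
      intro S; funext n; cases n <;> rfl
    simp only [this]

theorem interp_subst {A : Ty} : ∀ {ρ : ℕ → Set Term} {σ : ℕ → Ty},
    interp ρ (A.subst σ) = interp (fun n => interp ρ (σ n)) A := by
  induction A with
  | var n => intros; rfl
  | cst d => intros; rfl
  | arr A B hA hB => intro ρ ξ; simp only [interp, Ty.subst, hA, hB]
  | all A hA =>
    intro ρ σ
    simp only [interp, Ty.subst, hA]
    have : ∀ S : Set Term,
        (fun n => interp (fun n => n.casesOn S ρ) (Ty.upSub σ n) : ℕ → Set Term) =
        fun n => n.casesOn S fun n => interp ρ (σ n) := by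
      intro S; funext n; cases n
      · rfl
      · exact interp_rename
    simp only [this]

/-- Adequacy of the interpretation. Variables belong to every candidate, so the identity
substitution is an admissible `η`. -/
theorem TypF.subst_mem_interp {Γ : List Ty} {t : Term} {A : Ty} (h : TypF Γ t A) :
    ∀ {ρ : ℕ → Set Term} {η : ℕ → Term}, (∀ n, Candidate (ρ n)) →
      (∀ i B, Γ[i]? = some B → η i ∈ interp ρ B) → t.subst η ∈ interp ρ A := by
  induction h with
  | ax _ hi => intro ρ η _ H; exact H _ _ hi
  | arrI _ ih =>
    intro ρ η hρ H
    refine Term.lam_mem_arrow (candidate_interp hρ) (candidate_interp hρ) fun v hv => ?_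
    rw [Term.inst_subst_upSub]
    refine ih hρ fun i B hi => ?_
    cases i with
    | zero => cases hi; exact hv
    | succ i => exact H i B hi
  | arrE _ _ ih1 ih2 => intro ρ η hρ H; exact ih1 hρ H _ (ih2 hρ H)
  | allI _ _ ih =>
    intro ρ η hρ H S hS
    refine ih (fun n => ?_) fun i B hi => ?_
    · cases n; exacts [hS, hρ _]
    · rw [List.getElem?_map, Option.map_eq_some_iff] at hi
      obtain ⟨A, hA, rfl⟩ := hi
      rw [Ty.shift, interp_rename]
      exact H i A hA
  | @allE Γ t A C _ _ ih =>
    intro ρ η hρ H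
    rw [Ty.inst, interp_subst]
    have e : (fun n => interp ρ (Ty.single C n)) = fun n => n.casesOn (interp ρ C) ρ := by
      funext n; cases n <;> rfl
    rw [e]
    exact ih hρ H _ (candidate_interp hρ)

/-- Typable terms are strongly normalizing. -/
theorem TypF.sn {Γ : List Ty} {t : Term} {A : Ty} (h : TypF Γ t A) : SN t := by
  have hρ : ∀ n : ℕ, Candidate ((fun _ => {t | SN t}) n : Set Term) := fun _ => Term.candidate_SN
  have := h.subst_mem_interp (η := Term.var) hρ fun i B _ => (candidate_interp hρ).var i
  rw [Term.subst_var] at this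
  exact (candidate_interp hρ).sn this

open Term (Neutral WHStep WHRed Std)

/-! ### Types ending with `⊥` and output types -/

/-- The term `λ … λ x` with `k` abstractions, where `x` is the variable `m`. -/
def Term.lamsVar : ℕ → ℕ → Term
  | 0, m => .var m
  | k + 1, m => .lam (lamsVar k (m + 1))

theorem Term.lamsVar_rename (k : ℕ) : ∀ (m : ℕ) (ξ : ℕ → ℕ),
    (lamsVar k m).rename ξ = lamsVar k (ξ m) := by
  induction k with
  | zero => intros; rfl
  | succ k ih => intro m ξ; simp only [lamsVar, rename, ih]; rfl

theorem Term.lamsVar_subst (k : ℕ) : ∀ {m n : ℕ} {σ : ℕ → Term}, σ m = .var n →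
    (lamsVar k m).subst σ = lamsVar k n := by
  induction k with
  | zero => intro m n σ h; exact h
  | succ k ih =>
    intro m n σ h
    simp only [lamsVar, subst]
    rw [ih (n := n + 1)]
    simp only [upSub, h]; rfl

theorem Term.free_lamsVar (k : ℕ) : ∀ m : ℕ, (lamsVar k m).Free m := by
  induction k with
  | zero => intro m; rfl
  | succ k ih => intro m; exact ih (m + 1)

theorem Term.Normal.lam {u : Term} (h : u.Normal) : (Term.lam u).Normal := by
  intro v hv
  cases hv with
  | lam hv => exact h _ hv

theorem Term.Normal.app {u v : Term} (hu : u.Normal) (hn : u.Neutral) (hv : v.Normal) :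
    (Term.app u v).Normal := by
  intro w hw
  cases hw with
  | redex => exact hn
  | appL _ h => exact hu _ h
  | appR _ h => exact hv _ h

theorem Term.normal_var (n : ℕ) : (Term.var n).Normal := fun _ h => nomatch h

theorem Term.normal_lamsVar (k : ℕ) : ∀ m : ℕ, (lamsVar k m).Normal := by
  induction k with
  | zero => exact normal_var
  | succ k ih => intro m; exact (ih _).lam

/-- Substituting terms `λ … λ x` for some of the variables of a normal term does not erase all
the occurrences of these variables. -/
theorem Term.Normal.subst_lamsVar {t : Term} : t.Normal → ∀ {k m : ℕ → ℕ} {x : ℕ},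
    (∀ i, k i = 0 ∨ m i = x) →
    ∃ w, Betas (t.subst fun i => lamsVar (k i) (m i)) w ∧ w.Normal ∧
      (∀ i, t.Free i → m i = x → w.Free x) ∧
      (t.Neutral → w.Neutral ∨ ∃ k, w = lamsVar (k + 1) x) := by
  induction t with
  | var n =>
    intro _ k m x h
    refine ⟨_, .refl, normal_lamsVar _ _, ?_, fun _ => ?_⟩
    · intro i hi hx
      cases hi
      subst hx
      exact free_lamsVar (k n) (m n)
    · simp only [subst]
      rcases h n with h | h
      · rw [h]; exact Or.inl trivial
      · rw [h]
        cases k n with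
        | zero => exact Or.inl trivial
        | succ k => exact Or.inr ⟨k, rfl⟩
  | lam u ih =>
    intro hn k m x h
    have hu : u.Normal := fun v hv => hn _ (.lam hv)
    -- The bound variable must stay in place: it becomes `lamsVar 0 0`, which the alternative `k i =
    -- 0` allows.
    obtain ⟨w, hw, hwn, hf, -⟩ := ih hu (k := fun i => i.casesOn 0 k)
      (m := fun i => i.casesOn 0 fun n => m n + 1) (x := x + 1)
      (fun i => by cases i with
        | zero => exact Or.inl rfl
        | succ i => exact (h i).imp id (congrArg (· + 1)))
    refine ⟨Term.lam w, ?_, hwn.lam, fun i hi hx => hf (i + 1) hi (congrArg (· + 1) hx),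
      fun h => h.elim⟩
    simp only [subst]
    convert hw.lam using 3
    funext i
    cases i with
    | zero => rfl
    | succ i => exact lamsVar_rename _ _ _
  | app u v ihu ihv =>
    intro hn k m x h
    have hu : u.Normal := fun w hw => hn _ (.appL v hw)
    have hv : v.Normal := fun w hw => hn _ (.appR u hw)
    have hun : u.Neutral := by
      cases u with
      | lam u => exact hn _ (.redex u v)
      | _ => trivial
    obtain ⟨wu, hwu, hwun, hfu, hl⟩ := ihu hu h
    obtain ⟨wv, hwv, hwvn, hfv, -⟩ := ihv hv h
    rcases hl hun with hl | ⟨l, rfl⟩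
    · exact ⟨.app wu wv, hwu.app hwv, hwun.app hl hwvn,
        fun i hi hx => hi.imp (fun hi => hfu i hi hx) (fun hi => hfv i hi hx),
        fun _ => Or.inl trivial⟩
    -- Contracting this redex erases the argument with all its variables, but `x` survives in the
    -- function part.
    · have e : inst (lamsVar l (x + 1)) wv = lamsVar l x := lamsVar_subst l rfl
      refine ⟨lamsVar l x, (hwu.app hwv).tail (e ▸ .redex _ _), normal_lamsVar _ _,
        fun _ _ _ => free_lamsVar _ _, fun _ => ?_⟩
      cases l with
      | zero => exact Or.inl trivial
      | succ l => exact Or.inr ⟨l, rfl⟩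

/-- Abstract over all the arguments and return variable `j`: its type `c` is what has replaced the
final `⊥`. Thus `k` counts the arrows on the way to `⊥`. -/
theorem Ty.EndsBot.typF_lamsVar {A : Ty} (h : A.EndsBot) : A.Proper →
    ∀ {c : Ty} {σ : ℕ → Ty} {Δ : List Ty} {j : ℕ}, c.Proper → (∀ n, (σ n).Proper) →
      (∀ B ∈ Δ, B.Proper) → Δ[j]? = some c → ∃ k, TypF Δ (Term.lamsVar k j) (Ty.msub c σ A) := by
  induction h with
  | bot => intro _ c σ Δ j _ _ hΔ hj; exact ⟨0, .ax hΔ hj⟩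
  | @arr A B _ ih =>
    intro hA c σ Δ j hc hσ hΔ hj
    obtain ⟨k, hk⟩ := ih hA.2 hc hσ (cons_proper (hA.1.msub hc hσ) hΔ) (j := j + 1) hj
    exact ⟨k + 1, .arrI hk⟩
  | all _ ih =>
    intro hA c σ Δ j hc hσ hΔ hj
    obtain ⟨k, hk⟩ := ih hA.2 (hc.rename Nat.succ) (Ty.proper_upSub hσ) (map_shift_proper.2 hΔ)
      (j := j) (by rw [List.getElem?_map, hj]; rfl)
    exact ⟨k, .allI hk (hA.1.msub (m := 0) _ rfl)⟩

/-- Normal terms of an output type without `⊥` do not use variables of types ending with `⊥`. -/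
theorem IsOutput.closed_of_endsBot {D : Ty} (hD : IsOutput D) (hbot : ¬ D.HasBot) {Γ : List Ty}
    (hΓ : ∀ B ∈ Γ, B.EndsBot) {t : Term} (hn : t.Normal) (ht : TypF Γ t D) : t.Closed := by
  have hp : ∀ B ∈ [Ty.var 0], B.Proper := by simp [Ty.Proper]
  -- Type variable `0` is the new `X` that replaces `⊥`; the type variables of `Γ` move up by one to
  -- make room.
  have hk : ∀ i : ℕ, ∃ k, ∀ B, Γ[i]? = some B → TypF [Ty.var 0] (Term.lamsVar k 0)
      (Ty.msub (.var 0) (fun n => .var (n + 1)) B) := by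
    intro i
    cases hi : Γ[i]? with
    | none => exact ⟨0, fun B hB => nomatch hB⟩
    | some A =>
      have hA := List.mem_of_getElem? hi
      obtain ⟨k, hk⟩ := (hΓ A hA).typF_lamsVar (ht.ctx_proper A hA) (c := .var 0)
        (σ := fun n => .var (n + 1)) (Δ := [.var 0]) (j := 0) trivial (fun _ => trivial) hp rfl
      exact ⟨k, fun B hB => by cases hB; exact hk⟩
  choose k hk using hk
  obtain ⟨w, hw, hwn, hf, -⟩ := hn.subst_lamsVar (k := k) (m := fun _ => 0) (x := 0)
    fun _ => Or.inr rfl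
  have h1 : TypF [Ty.var 0] w D.shift := by
    have h := ht.msub (c := .var 0) (σ := fun n => .var (n + 1)) trivial fun _ => trivial
    -- With no `⊥` in `D`, the substitution acts on `D` as a mere shift.
    rw [Ty.msub_eq_subst_of_not_hasBot _ _ hbot] at h
    rw [Ty.shift, Ty.rename_eq_subst]
    refine (h.subst hp fun i B hi => ?_).betas hw
    rw [List.getElem?_map, Option.map_eq_some_iff] at hi
    obtain ⟨A, hA, rfl⟩ := hi
    exact hk i A hA
  have h2 : TypF [] (.lam w) (.all (.arr (.var 0) D.shift)) := .allI (.arrI h1) (Or.inl rfl)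
  exact fun i hi => hD.2.2 w hwn h2 (hf i hi rfl)

/-! ### Closures -/

/-- A term with an environment for its free variables, together with a typing of the term and an
instantiation of the type variables. -/
structure Closure where
  /-- The types of the free variables of the term. -/
  ctx : List Ty
  /-- The term. -/
  body : Term
  /-- The type of the term. -/
  type : Ty
  /-- The instantiation of the type variables. -/
  tyEnv : ℕ → Ty
  /-- The environment. -/
  env : ℕ → Term

/-- The environment of the closure is typable in `Γ`, and its body in F₀. -/
structure Closure.WellTyped (Γ : List Ty) (c : Closure) : Prop where
  body : TypF₀ c.ctx c.body c.type
  proper : ∀ n, (c.tyEnv n).Proper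
  env : ∀ j B, c.ctx[j]? = some B → TypF Γ (c.env j) (Ty.msub Ty.bot c.tyEnv B.star)

/-- The type of the variables that stand for the closure. -/
def Closure.starType (c : Closure) : Ty := Ty.msub Ty.bot c.tyEnv c.type.star

/-- `t` is an instance of the closure, where the body is replaced by some term that has a standard
reduction to it, and the environment is instantiated by `σ`. -/
def Closure.Instance (c : Closure) (σ : ℕ → Term) (t : Term) : Prop :=
  ∃ (θ : Term) (η : ℕ → Term), Std θ c.body ∧
    (∀ j < c.ctx.length, η j = (c.env j).subst σ) ∧ t = θ.subst η

/-- A context for a variable of type `¬D` and for variables standing for closures, each of which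
uses the preceding variables only. -/
structure ClosureCtx (D : Ty) (Γ : List Ty) (cl : ℕ → Closure) : Prop where
  proper : ∀ B ∈ Γ, B.Proper
  zero : Γ[0]? = some D.neg
  closure : ∀ i A, 0 < i → Γ[i]? = some A →
    A = (cl i).starType ∧ (cl i).WellTyped (Γ.take i)

/-- The substitution replaces the variables by instances of the closures. -/
def Realizes (Γ : List Ty) (cl : ℕ → Closure) (σ : ℕ → Term) : Prop :=
  ∀ i, 0 < i → i < Γ.length → (cl i).Instance σ (σ i)

/-- Free variables of a term typed in `Γ` lie below `Γ.length`, so values given to fresh closure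
names do not disturb it. -/
theorem TypF.subst_update {Γ : List Ty} {t : Term} {A : Ty} (h : TypF Γ t A) {n : ℕ}
    (hn : Γ.length ≤ n) (σ : ℕ → Term) (v : Term) :
    t.subst (Function.update σ n v) = t.subst σ :=
  Term.subst_congr t fun i hi => Function.update_of_ne (by have := h.lt_length hi; omega) _ _

theorem Closure.Instance.update {Γ : List Ty} {c : Closure} (hc : c.WellTyped Γ)
    {σ : ℕ → Term} {t v : Term} (h : c.Instance σ t) {n : ℕ} (hn : Γ.length ≤ n) :
    c.Instance (Function.update σ n v) t := by
  obtain ⟨θ, η, hθ, hη, rfl⟩ := h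
  refine ⟨θ, η, hθ, fun j hj => ?_, rfl⟩
  rw [hη j hj, (hc.env j _ (List.getElem?_eq_getElem hj)).subst_update hn]

theorem Closure.WellTyped.starType_proper {Γ : List Ty} {c : Closure} (h : c.WellTyped Γ) :
    c.starType.Proper :=
  h.body.toTypF.proper.star.msub (c := Ty.bot) trivial h.proper

theorem ClosureCtx.length_pos {D : Ty} {Γ : List Ty} {cl : ℕ → Closure} (h : ClosureCtx D Γ cl) :
    0 < Γ.length := (List.getElem?_eq_some_iff.1 h.zero).1

theorem ClosureCtx.snoc {D : Ty} {Γ : List Ty} {cl : ℕ → Closure} (h : ClosureCtx D Γ cl)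
    {c : Closure} (hc : c.WellTyped Γ) :
    ClosureCtx D (Γ ++ [c.starType]) (Function.update cl Γ.length c) where
  proper B hB := (List.mem_append.1 hB).elim (h.proper B) fun hB => by
    rw [List.mem_singleton.1 hB]; exact hc.starType_proper
  zero := getElem?_append_of_eq_some _ h.zero
  closure := by
    intro i A hi hA
    have hl := (List.getElem?_eq_some_iff.1 hA).1
    rw [List.length_append, List.length_singleton] at hl
    rcases Nat.lt_succ_iff_lt_or_eq.1 hl with hl | rfl
    · rw [List.getElem?_append_left hl] at hA
      rw [Function.update_of_ne hl.ne, List.take_append_of_le_length hl.le]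
      exact h.closure i A hi hA
    · rw [List.getElem?_append_right le_rfl, Nat.sub_self] at hA
      rw [Function.update_self, List.take_left]
      cases hA
      exact ⟨rfl, hc⟩

theorem Realizes.snoc {D : Ty} {Γ : List Ty} {cl : ℕ → Closure} (h : ClosureCtx D Γ cl)
    {c : Closure} (hc : c.WellTyped Γ) {σ : ℕ → Term} (hσ : Realizes Γ cl σ) {t : Term}
    (ht : c.Instance σ t) :
    Realizes (Γ ++ [c.starType]) (Function.update cl Γ.length c)
      (Function.update σ Γ.length t) := by
  intro i hi hl
  rw [List.length_append, List.length_singleton] at hl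
  rcases Nat.lt_succ_iff_lt_or_eq.1 hl with hl | rfl
  · rw [Function.update_of_ne hl.ne, Function.update_of_ne hl.ne]
    refine (hσ i hi hl).update (h.closure i _ hi (List.getElem?_eq_getElem hl)).2 ?_
    rw [List.length_take]; omega
  · rw [Function.update_self, Function.update_self]
    exact ht.update hc le_rfl

theorem Spine.map_subst_update {Γ : List Ty} {A F : Ty} {l : List Term} (h : Spine Γ A l F)
    (σ : ℕ → Term) (v : Term) :
    l.map (Term.subst (Function.update σ Γ.length v)) = l.map (Term.subst σ) := by
  induction h with
  | nil A => rfl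
  | inst _ _ ih => exact ih
  | app ha _ ih => rw [List.map_cons, List.map_cons, ih, ha.subst_update le_rfl]

/-- Evaluation of a closure in head position: uniformly in the instances, it leads either to an
element of its environment, or to another closure after at least one step. -/
theorem TypF₀.eval_closure {D : Ty} {Δ : List Ty} {u : Term} {A : Ty} (h : TypF₀ Δ u A) :
    ∀ {s : ℕ → Ty} {ρ : ℕ → Term} {l : List Term} {Γ : List Ty} {cl : ℕ → Closure},
      ClosureCtx D Γ cl → (∀ n, (s n).Proper) →
      (∀ j B, Δ[j]? = some B → TypF Γ (ρ j) (Ty.msub Ty.bot s B.star)) →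
      Spine Γ (Ty.msub Ty.bot s A.star) l Ty.bot →
      ∃ Γ' cl' e, ClosureCtx D Γ' cl' ∧ TypF Γ' e Ty.bot ∧
        ∀ σ, Realizes Γ cl σ → ∀ θ η, Std θ u → (∀ j < Δ.length, η j = (ρ j).subst σ) →
          ∃ σ', Realizes Γ' cl' σ' ∧ σ' 0 = σ 0 ∧
            WHRed ((θ.subst η).apps (l.map (Term.subst σ))) (e.subst σ') ∧
            ((∃ j < Δ.length, ∃ l', e = (ρ j).apps l') ∨
              Relation.TransGen WHStep ((θ.subst η).apps (l.map (Term.subst σ)))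
                (e.subst σ')) := by
  induction h with
  | @ax Δ i A _ hi =>
    intro s ρ l Γ cl hcl _ hρ hl
    have hlt := (List.getElem?_eq_some_iff.1 hi).1
    refine ⟨Γ, cl, (ρ i).apps l, hcl, hl.typF (hρ i A hi), fun σ hσ θ η hθ hη =>
      ⟨σ, hσ, rfl, ?_, Or.inl ⟨i, hlt, l, rfl⟩⟩⟩
    cases hθ with
    | var hθ =>
      rw [Term.apps_subst, ← hη i hlt]
      exact WHRed.apps (hθ.subst η) _
  | @arrI Δ u B C hu _ =>
    intro s ρ l Γ cl hcl hs hρ hl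
    cases hl with
    | @app _ _ _ a l ha hl =>
      -- The abstraction consumes the first argument `a` of the spine: its body, with `a` put in the
      -- environment, becomes a closure under the fresh name `Γ.length`. The redex contracted here
      -- is the strict step.
      have hc : Closure.WellTyped Γ ⟨B :: Δ, u, C, s, Term.cons a ρ⟩ :=
        { body := hu
          proper := hs
          env := fun j B' hj => by
            cases j with
            | zero => cases hj; exact ha
            | succ j => exact hρ j B' hj }
      have hcl' := hcl.snoc hc
      have hv : TypF (Γ ++ [Ty.msub Ty.bot s C.star]) (.var Γ.length)
          (Ty.msub Ty.bot s C.star) := .ax hcl'.proper (by simp)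
      refine ⟨_, _, (Term.var Γ.length).apps l, hcl',
        (hl.append fun B hB => hcl'.proper B (List.mem_append_right _ hB)).typF hv,
        fun σ hσ θ η hθ hη => ?_⟩
      cases hθ with
      | @lam _ θ' _ hθ hθ' =>
        refine ⟨_, hσ.snoc hcl hc (t := θ'.subst (Term.cons (a.subst σ) η))
          ⟨θ', _, hθ', fun j hj => ?_, rfl⟩,
          Function.update_of_ne hcl.length_pos.ne _ _, ?_⟩
        · cases j with
          | zero => rfl
          | succ j => exact hη j (Nat.lt_of_succ_lt_succ hj)
        · have key : Relation.TransGen WHStep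
              ((θ.subst η).apps ((a :: l).map (Term.subst σ)))
              (((Term.var Γ.length).apps l).subst (Function.update σ Γ.length
                (θ'.subst (Term.cons (a.subst σ) η)))) := by
            rw [Term.apps_subst, hl.map_subst_update, ← Term.inst_subst_upSub]
            simp only [Term.subst, Function.update_self]
            exact Relation.TransGen.tail' (WHRed.apps (hθ.subst η) _)
              (WHStep.apps (.redex _ _) _)
          exact ⟨key.to_reflTransGen, Or.inr key⟩
  | @arrE Δ u v B C hu hv ihu _ =>
    intro s ρ l Γ cl hcl hs hρ hl
    -- The argument `v` is not evaluated: it is suspended as a closure, whose name is pushed on the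
    -- spine.
    have hc : Closure.WellTyped Γ ⟨Δ, v, B, s, ρ⟩ := ⟨hv, hs, hρ⟩
    have hcl' := hcl.snoc hc
    have hp := fun B hB => hcl'.proper B (List.mem_append_right _ hB)
    have hvar : TypF (Γ ++ [Ty.msub Ty.bot s B.star]) (.var Γ.length)
        (Ty.msub Ty.bot s B.star) := .ax hcl'.proper (by simp)
    obtain ⟨Γ', cl', e, h1, h2, h3⟩ := ihu (l := .var Γ.length :: l) hcl' hs
      (fun j B hj => (hρ j B hj).append hp) (.app hvar (hl.append hp))
    refine ⟨Γ', cl', e, h1, h2, fun σ hσ θ η hθ hη => ?_⟩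
    cases hθ with
    | @app _ a b _ _ hθ ha hb =>
      obtain ⟨σ', k1, k2, k3, k4⟩ := h3 _ (hσ.snoc hcl hc ⟨b, η, hb, hη, rfl⟩) a η ha
        fun j hj => by
          rw [hη j hj, (hρ j _ (List.getElem?_eq_getElem hj)).subst_update le_rfl]
      have hred := WHRed.apps (hθ.subst η) (l.map (Term.subst σ))
      rw [List.map_cons, hl.map_subst_update] at k3 k4
      simp only [Term.subst, Function.update_self] at k3 k4
      exact ⟨σ', k1, k2.trans (Function.update_of_ne hcl.length_pos.ne _ _), hred.trans k3,
        k4.imp id fun k => Relation.TransGen.trans_right hred k⟩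
  | @allI Δ u A hu _ ih =>
    intro s ρ l Γ cl hcl hs hρ hl
    cases hl with
    | @inst _ C _ _ hC hl =>
      have hl : Spine Γ ((Ty.msub (Ty.shift Ty.bot) (Ty.upSub s) A.star).inst C) l Ty.bot := hl
      -- The type `C` chosen by the spine becomes the value of the bound type variable in the type
      -- environment.
      rw [Ty.inst_msub] at hl
      obtain ⟨Γ', cl', e, h1, h2, h3⟩ := ih (ρ := ρ) hcl (Ty.proper_cons hC hs)
        (fun j B hj => by
          rw [List.getElem?_map, Option.map_eq_some_iff] at hj
          obtain ⟨B', hB', rfl⟩ := hj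
          rw [Ty.shift, Ty.star_rename]
          exact (Ty.msub_cons_shift B'.star Ty.bot C s).symm ▸ hρ j B' hB') hl
      rw [List.length_map] at h3
      exact ⟨Γ', cl', e, h1, h2, h3⟩

/-! ### Head reduction under closures -/

/-- The head variable of a term, and `0` for terms headed by an abstraction. -/
def Term.headVar : Term → ℕ
  | var n => n
  | app u _ => headVar u
  | lam _ => 0

theorem Term.headVar_apps (l : List Term) : ∀ t : Term, (t.apps l).headVar = t.headVar := by
  induction l with
  | nil => intro t; rfl
  | cons a l ih => intro t; exact ih (t.app a)

theorem Term.headVar_free (t : Term) : t.headVar = 0 ∨ t.Free t.headVar := by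
  induction t with
  | var n => exact Or.inr rfl
  | app u v hu _ => exact hu.imp id Or.inl
  | lam u _ => exact Or.inl rfl

/-- The realizer `σ₀` serves only for termination: the induction is lexicographic, on the weak head
reductions of `e.subst σ₀` and then on a bound `N` for the head variable, which is reset after each
actual step. Since `τ` is found before `σ` is given, it is common to all realizers. -/
theorem ClosureCtx.head_reduction {D : Ty} {w : Term}
    (hw : Acc (Relation.TransGen fun a b => WHStep b a) w) :
    ∀ (N : ℕ) {Γ : List Ty} {cl : ℕ → Closure} {e : Term} {σ₀ : ℕ → Term},
      ClosureCtx D Γ cl → TypF Γ e Ty.bot → e.headVar < N → Realizes Γ cl σ₀ →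
      e.subst σ₀ = w →
      ∃ Γ' cl' τ, ClosureCtx D Γ' cl' ∧ TypF Γ' τ D ∧
        ∀ σ, Realizes Γ cl σ → ∃ σ' : ℕ → Term,
          WHRed (e.subst σ) (.app (σ 0) (τ.subst σ')) := by
  induction hw with
  | intro w _ ihw =>
    intro N
    induction N with
    | zero => intro _ _ _ _ _ _ h; exact absurd h (Nat.not_lt_zero _)
    | succ N ihN =>
      intro Γ cl e σ₀ hcl he hN hσ₀ hew
      rcases e.exists_apps with ⟨i, l, rfl⟩ | ⟨u, l, rfl⟩
      · have hi : i < Γ.length := by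
          rcases Term.headVar_free ((Term.var i).apps l) with h | h
          · rw [Term.headVar_apps] at h; cases h; exact hcl.length_pos
          · rw [Term.headVar_apps] at h; exact he.lt_length h
        rw [Term.headVar_apps] at hN
        -- `GenSpine` with target `⊥` unfolds to `Spine`, as `⊥` is not quantified.
        have hl : Spine Γ Γ[i] l Ty.bot := he.genSpine rfl (List.getElem?_eq_getElem hi)
        rcases Nat.eq_zero_or_pos i with rfl | hpos
        · have h0 := hcl.zero
          rw [List.getElem?_eq_getElem hi, Option.some_inj] at h0
          rw [h0] at hl
          cases hl with
          | @app _ _ _ a _ ha hl =>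
            cases hl with
            | nil => exact ⟨Γ, cl, a, hcl, ha, fun σ _ => ⟨σ, .refl⟩⟩
        · obtain ⟨hA, hc⟩ := hcl.closure i _ hpos (List.getElem?_eq_getElem hi)
          rw [hA] at hl
          have henv : ∀ j B, (cl i).ctx[j]? = some B →
              TypF Γ ((cl i).env j) (Ty.msub Ty.bot (cl i).tyEnv B.star) := fun j B hj =>
            List.take_append_drop i Γ ▸ (hc.env j B hj).append
              fun B hB => hcl.proper B (List.mem_of_mem_drop hB)
          obtain ⟨Γ', cl', e', h1, h2, h3⟩ := hc.body.eval_closure hcl hc.proper henv hl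
          have step : ∀ σ, Realizes Γ cl σ → ∃ σ', Realizes Γ' cl' σ' ∧ σ' 0 = σ 0 ∧
              WHRed (((Term.var i).apps l).subst σ) (e'.subst σ') ∧
              ((∃ j < (cl i).ctx.length, ∃ l', e' = ((cl i).env j).apps l') ∨
                Relation.TransGen WHStep (((Term.var i).apps l).subst σ) (e'.subst σ')) := by
            intro σ hσ
            obtain ⟨θ, η, hθ, hη, ht⟩ := hσ i hpos hi
            rw [Term.apps_subst, Term.subst, ht]
            exact h3 σ hσ θ η hθ hη
          have fin : (∃ Γ'' cl'' τ, ClosureCtx D Γ'' cl'' ∧ TypF Γ'' τ D ∧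
              ∀ σ, Realizes Γ' cl' σ → ∃ σ' : ℕ → Term,
                WHRed (e'.subst σ) (.app (σ 0) (τ.subst σ'))) →
              ∃ Γ'' cl'' τ, ClosureCtx D Γ'' cl'' ∧ TypF Γ'' τ D ∧
              ∀ σ, Realizes Γ cl σ → ∃ σ' : ℕ → Term,
                WHRed (((Term.var i).apps l).subst σ) (.app (σ 0) (τ.subst σ')) := by
            rintro ⟨Γ'', cl'', τ, k1, k2, k3⟩
            refine ⟨Γ'', cl'', τ, k1, k2, fun σ hσ => ?_⟩
            obtain ⟨σ', hσ', h0, hr, -⟩ := step σ hσ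
            obtain ⟨σ'', hσ''⟩ := k3 σ' hσ'
            rw [h0] at hσ''
            exact ⟨σ'', hr.trans hσ''⟩
          apply fin
          obtain ⟨σ', hσ', -, hr, hor⟩ := step σ₀ hσ₀
          rw [hew] at hr hor
          have outer (h : Relation.TransGen WHStep w (e'.subst σ')) :=
            ihw _ (Relation.transGen_swap.2 h) _ h1 h2 (Nat.lt_succ_self _) hσ' rfl
          -- If an environment entry was fetched and `w` has not moved, the head variable must
          -- decrease; otherwise a step was made from `w` and the outer induction applies.
          rcases hor with ⟨j, hj, l', rfl⟩ | h
          · rcases Relation.reflTransGen_iff_eq_or_transGen.1 hr with h | h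
            · refine ihN h1 h2 ?_ hσ' h
              rw [Term.headVar_apps]
              -- Closure `i` is typed in `Γ.take i`, so its environment uses only variables below
              -- `i`; for an entry headed by an abstraction the default value `0` is also below `i`.
              have hi' : ((cl i).env j).headVar < i := by
                rcases Term.headVar_free ((cl i).env j) with h | h
                · rwa [h]
                · have := (hc.env j _ (List.getElem?_eq_getElem hj)).lt_length h
                  rw [List.length_take] at this; omega
              simp only [Term.headVar] at hN
              omega
            · exact outer h
          · exact outer h
      · cases l with
        -- A bare abstraction cannot have type `⊥`.
        | nil => exact (TypF.lamTyp he rfl : LamTyp Γ u Ty.bot).elim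
        | cons a l =>
          have hs : WHStep ((Term.lam u).apps (a :: l)) ((u.inst a).apps l) :=
            WHStep.apps (.redex u a) l
          obtain ⟨Γ', cl', τ, k1, k2, k3⟩ := ihw _
            (.single (hew ▸ hs.subst σ₀)) _ hcl (he.beta hs.beta) (Nat.lt_succ_self _) hσ₀ rfl
          refine ⟨Γ', cl', τ, k1, k2, fun σ hσ => ?_⟩
          obtain ⟨σ', hσ'⟩ := k3 σ hσ
          exact ⟨σ', .head (hs.subst σ) hσ'⟩

theorem ClosureCtx.endsBot {D : Ty} {Γ : List Ty} {cl : ℕ → Closure} (h : ClosureCtx D Γ cl) :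
    ∀ B ∈ Γ, B.EndsBot := by
  intro B hB
  obtain ⟨i, hi⟩ := List.mem_iff_getElem?.1 hB
  rcases Nat.eq_zero_or_pos i with rfl | hpos
  · rw [h.zero] at hi; cases hi; exact .arr .bot
  · rw [(h.closure i B hpos hi).1]; exact Ty.endsBot_star_msub _ _

theorem Term.SN.acc_transGen_whStep {t : Term} (h : t.SN) :
    Acc (Relation.TransGen fun a b => WHStep b a) t :=
  (Subrelation.accessible (fun h => WHStep.beta h) h : Acc (fun a b => WHStep b a) t).transGen

end SystemF

/-! ### The storage operator theorem. -/

open SystemF in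
theorem mainTheorem5 (D : SystemF.Ty) (hD : SystemF.IsSyntacticalDataType D) (hbot : ¬ D.HasBot)
    (T : SystemF.Term) (hT : SystemF.TypF [] T (SystemF.Ty.arr D.star D.neg.neg)) :
    SystemF.IsStorageOperator D T := by
  obtain ⟨hin, hout⟩ := hD
  refine ⟨hT.closed, fun t ht => ?_⟩
  obtain ⟨u, htu, hu⟩ := ht.sn.exists_normal
  have hu0 : TypF₀ [] u D := hin.2.2 u hu (ht.betas htu)
  have hp : ∀ B ∈ [D.neg, D.star], B.Proper := by
    simp only [List.mem_cons, List.not_mem_nil, or_false]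
    rintro B (rfl | rfl)
    exacts [⟨hin.1, trivial⟩, hin.1.star]
  have hp' : ∀ B ∈ [D.neg], B.Proper := fun B hB =>
    hp B (List.mem_cons.2 (Or.inl (List.mem_singleton.1 hB)))
  let c : Closure := ⟨[], u, D, Ty.var, Term.var⟩
  -- Variable `0` plays the role of `f` and variable `1` stands for `u`; the closure attached to any
  -- other index is immaterial.
  have hctx : ClosureCtx D [D.neg, D.star] fun _ => c :=
    { proper := hp
      zero := rfl
      closure := by
        intro i A hi hA
        match i, hi, hA with
        | 1, _, hA =>
          cases hA
          exact ⟨(Ty.msub_var _).symm, hu0, fun _ => trivial, fun j B hj => nomatch hj⟩ }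
  have hreal : ∀ θ f, Term.Std θ u →
      Realizes [D.neg, D.star] (fun _ => c) (Term.cons (.var f) fun _ => θ) := by
    intro θ f hθ i hi hl
    match i, hi with
    | i + 1, _ =>
      -- `θ` may have free variables although `u` is closed; the empty context of `c` leaves the
      -- environment unconstrained, so the identity keeps them.
      exact ⟨θ, Term.var, hθ, fun j hj => absurd hj (Nat.not_lt_zero _), (Term.subst_var θ).symm⟩
  have he : TypF [D.neg, D.star] (.app (.app T (.var 1)) (.var 0)) Ty.bot :=
    .arrE (.arrE (hT.append hp) (.ax hp rfl)) (.ax hp rfl)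
  have hsub : ∀ θ f, (Term.app (.app T (.var 1)) (.var 0)).subst
      (Term.cons (.var f) fun _ => θ) = .app (.app T θ) (.var f) := fun θ f => by
    simp only [Term.subst, hT.closed.subst]; rfl
  -- The reference run takes `θ = u`, where typability gives strong normalization; an arbitrary `θ`
  -- equivalent to `u` need not be strongly normalizing.
  have he' : TypF [D.neg] (.app (.app T u) (.var 0)) Ty.bot :=
    .arrE (.arrE (hT.append hp') (hu0.star.append hp')) (.ax hp' rfl)
  obtain ⟨Γ, cl, τ, h1, h2, h3⟩ := ClosureCtx.head_reduction he'.sn.acc_transGen_whStep _ hctx he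
    (Nat.lt_succ_self _) (hreal u 0 (.refl u)) (hsub u 0)
  -- Only the normal form of `τ` is known to be closed; `τ` itself may contain closure variables,
  -- which `σ` instantiates.
  obtain ⟨τ', hτ, hn⟩ := h2.sn.exists_normal
  have h4 := h2.betas hτ
  have hcl := hout.closed_of_endsBot hbot h1.endsBot hn h4
  refine ⟨τ, τ', hτ.betaEq, h4.change (by simp) fun i B hi => (hcl i hi).elim, ?_⟩
  intro θ hθ f _
  -- As `u` is normal, confluence turns the equivalence into a reduction from `θ` to `u`, which
  -- standardization then makes standard.
  have hθu : Term.Std θ u := (Term.BetaEq.betas_of_normal (.trans _ _ _ hθ htu.betaEq) hu).std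
  have := h3 _ (hreal θ f hθu)
  rwa [hsub] at this
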